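/- **Theorem 3 (Capillary-gravity waves).** Let $\rho_1,\rho_2,\sigma,h_1,h_2>0$ and $g\in\mathbb R$ be constants. Let $\eta\in C^2(\mathbb R^2)$ satisfy $-h_1<\inf\eta$ and $\sup\eta<h_2$, and put $$\Omega_1=\{(x,y,z):-h_1<z<\eta(x,y)\},\qquad \Omega_2=\{(x,y,z):\eta(x,y)<z<h_2\}.$$ For $i=1,2$ let $\boldsymbol u_i=(u_i,v_i,w_i)\in C^1(\overline{\Omega_i};\mathbb R^3)$ and $P_i\in C^1(\overline{\Omega_i})$ solve the internal capillary-gravity wave problem $$\rho_i(\boldsymbol u_i\cdot\nabla)\boldsymbol u_i=-\nabla P_i+\rho_i(0,0,-g),\qquad \nabla\cdot\boldsymbol u_i=0\qquad\text{in }\Omega_i,$$ $$u_i\eta_x+v_i\eta_y=w_i\quad\text{on }z=\eta(x,y),\qquad w_1=0\ \text{ on }z=-h_1,\qquad w_2=0\ \text{ on }z=h_2,$$ $$P_2-P_1=\sigma\,\frac{(1+\eta_y^2)\eta_{xx}-2\eta_x\eta_y\eta_{xy}+(1+\eta_x^2)\eta_{yy}}{(1+\eta_x^2+\eta_y^2)^{3/2}}\quad\text{on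 }z=\eta(x,y).$$ Assume that 1. the vorticities $\boldsymbol\omega_i=\nabla\times\boldsymbol u_i$ are constant in $\Omega_i$, nonzero, and parallel to each other; 2. $\|\boldsymbol u_1\|_{C^1(\Omega_1)}$, $\|\boldsymbol u_2\|_{C^1(\Omega_2)}$ and $\|\eta\|_{C^2(\mathbb R^2)}$ are finite; 3. $\sup\,(\partial_zP_1-\partial_zP_2)|_{z=\eta}<0$. Then the wave is two dimensional. That is, there is a horizontal unit vector $\boldsymbol e=(a,b,0)$, parallel to both $\boldsymbol\omega_1$ and $\boldsymbol\omega_2$, such that $\eta$ is constant along all lines in $\mathbb R^2$ of direction $(a,b)$, and for $i=1,2$ the velocity $\boldsymbol u_i$ and the pressure $P_i$ do not vary in the direction $\boldsymbol e$ in $\overline{\Omega_i}$, and $\boldsymbol u_i\cdot\boldsymbol e$ is constant in $\overline{\Omega_i}$. (In horizontal axes with $\boldsymbol e$ as the $y$-axis: $\boldsymbol u_i=(u_i(x,z),V_i,w_i(x,z))$ with constants $V_i$, $P_i=P_i(x,z)$ and $\eta=\eta(x)$.) -/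

import Mathlib

/-- The partial derivative `∂f/∂x_j` at `p` of a scalar function of `n` real variables. -/
noncomputable def pd {n : ℕ} (j : Fin n) (f : (Fin n → ℝ) → ℝ) (p : Fin n → ℝ) : ℝ :=
  fderiv ℝ f p (Pi.single j 1)

/-- The partial derivative at `p` of a function that is differentiable on `S` up to its boundary. -/
noncomputable def pdWithin {n : ℕ} (S : Set (Fin n → ℝ)) (j : Fin n) (f : (Fin n → ℝ) → ℝ)
    (p : Fin n → ℝ) : ℝ :=
  fderivWithin ℝ f S p (Pi.single j 1)

/-- `f` has finite `C^k` norm on the open set `S`: its derivatives of order at most `k`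
are bounded there. -/
def FiniteCkNorm {n : ℕ} {F : Type*} [NormedAddCommGroup F] [NormedSpace ℝ F]
    (k : ℕ) (S : Set (Fin n → ℝ)) (f : (Fin n → ℝ) → F) : Prop :=
  ∃ M : ℝ, ∀ m ≤ k, ∀ p ∈ S, ‖iteratedFDeriv ℝ m f p‖ ≤ M

/-- The curl of a vector field on `ℝ³`. -/
noncomputable def curl (u : (Fin 3 → ℝ) → (Fin 3 → ℝ)) (p : Fin 3 → ℝ) : Fin 3 → ℝ :=
  ![pd 1 (fun q => u q 2) p - pd 2 (fun q => u q 1) p,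
    pd 2 (fun q => u q 0) p - pd 0 (fun q => u q 2) p,
    pd 0 (fun q => u q 1) p - pd 1 (fun q => u q 0) p]

/-- The lower layer `-h₁ < z < η(x, y)`. -/
def lowerLayer (h₁ : ℝ) (η : (Fin 2 → ℝ) → ℝ) : Set (Fin 3 → ℝ) :=
  {p | -h₁ < p 2 ∧ p 2 < η ![p 0, p 1]}

/-- The upper layer `η(x, y) < z < h₂`. -/
def upperLayer (h₂ : ℝ) (η : (Fin 2 → ℝ) → ℝ) : Set (Fin 3 → ℝ) :=
  {p | η ![p 0, p 1] < p 2 ∧ p 2 < h₂}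

/-- The point of the interface `z = η(x, y)` above `(x, y)`. -/
def interfacePoint (η : (Fin 2 → ℝ) → ℝ) (x : Fin 2 → ℝ) : Fin 3 → ℝ :=
  ![x 0, x 1, η x]

/-- A classical solution of the steady incompressible Euler equations in `Ω` with density `ρ` and
gravity `(0, 0, -g)`: velocity `u` and pressure `P` are `C¹` up to the boundary. -/
structure IsSteadyEuler (ρ g : ℝ) (Ω : Set (Fin 3 → ℝ)) (u : (Fin 3 → ℝ) → (Fin 3 → ℝ))
    (P : (Fin 3 → ℝ) → ℝ) : Prop where
  contDiffOn_velocity : ContDiffOn ℝ 1 u (closure Ω)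
  contDiffOn_pressure : ContDiffOn ℝ 1 P (closure Ω)
  momentum : ∀ p ∈ Ω, ∀ k : Fin 3,
    ρ * ∑ j : Fin 3, u p j * pd j (fun q => u q k) p = -pd k P p + ρ * (![0, 0, -g] : Fin 3 → ℝ) k
  incompressible : ∀ p ∈ Ω, ∑ j : Fin 3, pd j (fun q => u q j) p = 0

/-- The mean curvature expression
`((1 + η_y²) η_xx - 2 η_x η_y η_xy + (1 + η_x²) η_yy) / (1 + η_x² + η_y²)^(3/2)`. -/
noncomputable def meanCurvature (η : (Fin 2 → ℝ) → ℝ) (x : Fin 2 → ℝ) : ℝ :=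
  ((1 + pd 1 η x ^ 2) * pd 0 (pd 0 η) x - 2 * pd 0 η x * pd 1 η x * pd 1 (pd 0 η) x
      + (1 + pd 0 η x ^ 2) * pd 1 (pd 1 η) x)
    / (1 + pd 0 η x ^ 2 + pd 1 η x ^ 2) ^ (3 / 2 : ℝ)

/-- A classical solution of the internal capillary-gravity wave problem in the channel
`-h₁ < z < h₂`; index `1` is the lower fluid, index `2` the upper fluid. -/
structure IsCapillaryGravityWave (ρ₁ ρ₂ g σ h₁ h₂ : ℝ) (η : (Fin 2 → ℝ) → ℝ)
    (u₁ u₂ : (Fin 3 → ℝ) → (Fin 3 → ℝ)) (P₁ P₂ : (Fin 3 → ℝ) → ℝ) : Prop where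
  contDiff_interface : ContDiff ℝ 2 η
  /-- `-h₁ < inf η` -/
  above_bed : ∃ δ : ℝ, 0 < δ ∧ ∀ x, -h₁ + δ ≤ η x
  /-- `sup η < h₂` -/
  below_lid : ∃ δ : ℝ, 0 < δ ∧ ∀ x, η x ≤ h₂ - δ
  euler_lower : IsSteadyEuler ρ₁ g (lowerLayer h₁ η) u₁ P₁
  euler_upper : IsSteadyEuler ρ₂ g (upperLayer h₂ η) u₂ P₂
  kinematic_lower : ∀ x, u₁ (interfacePoint η x) 0 * pd 0 η x + u₁ (interfacePoint η x) 1 * pd 1 η x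
    = u₁ (interfacePoint η x) 2
  kinematic_upper : ∀ x, u₂ (interfacePoint η x) 0 * pd 0 η x + u₂ (interfacePoint η x) 1 * pd 1 η x
    = u₂ (interfacePoint η x) 2
  kinematic_bed : ∀ p, p 2 = -h₁ → u₁ p 2 = 0
  kinematic_lid : ∀ p, p 2 = h₂ → u₂ p 2 = 0
  young_laplace : ∀ x,
    P₂ (interfacePoint η x) - P₁ (interfacePoint η x) = σ * meanCurvature η x

/-- The flow `(u, P)` in the closed region `D` is two dimensional with respect to the direction `e`:
it does not vary along `e`, and the velocity component along `e` is constant. -/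
def IsTwoDimensionalFlow (e : Fin 3 → ℝ) (D : Set (Fin 3 → ℝ))
    (u : (Fin 3 → ℝ) → (Fin 3 → ℝ)) (P : (Fin 3 → ℝ) → ℝ) : Prop :=
  (∀ p ∈ D, ∀ t : ℝ, p + t • e ∈ D → u (p + t • e) = u p ∧ P (p + t • e) = P p) ∧
    ∃ V : ℝ, ∀ p ∈ D, u p ⬝ᵥ e = V

/-!
The circulation of the horizontal velocity around a large horizontal square is at most linear in its
side, so a constant vertical vorticity must vanish and the vorticities are parallel to a common
horizontal unit vector `e`. The Lamb vector `u × ω` is the gradient of the Bernoulli head, and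
the symmetry of its derivative shows that the velocity components orthogonal to `e` do not vary
along `e`. Boundedness then makes `u · e` constant, which leaves a planar flow whose complex
velocity, up to a shear, is holomorphic; the identity theorem and the Bernoulli head extend
invariance along `e` to any two points of a layer at the same height, even when the segment between
them leaves the layer.

Consequently, where `η (x + t e) > η x`, the pressure jump at `x + t e` exceeds the one at `x` by at
least `δ (η (x + t e) - η x)`. By the Young–Laplace law the curvature of the translate `η (· + t e)`
is then too large for the Omori–Yau maximum principle, so that `η (x + t e) ≤ η x` for all `x`
and `t`.
-/

open Filter Topology Set

section Line

variable {E F : Type*} [NormedAddCommGroup E] [NormedSpace ℝ E] [NormedAddCommGroup F]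
  [NormedSpace ℝ F] {p v : E}

lemma hasDerivAt_comp_line {f : E → F} {s : ℝ} (hf : DifferentiableAt ℝ f (p + s • v)) :
    HasDerivAt (fun s : ℝ => f (p + s • v)) (fderiv ℝ f (p + s • v) v) s := by
  have hline : HasDerivAt (fun s : ℝ => p + s • v) v s := by
    simpa using ((hasDerivAt_id s).smul_const v).const_add p
  exact hf.hasFDerivAt.comp_hasDerivAt s hline

lemma comp_line_eq_of_fderiv_eq {f : E → F} {k : F}
    (hf : ∀ s : ℝ, DifferentiableAt ℝ f (p + s • v))
    (hk : ∀ s : ℝ, fderiv ℝ f (p + s • v) v = k) (t : ℝ) : f (p + t • v) = f p + t • k := by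
  have hderiv : ∀ s : ℝ, HasDerivAt (fun s : ℝ => f (p + s • v) - s • k) 0 s := fun s => by
    have hid := (hasDerivAt_id' s).smul_const k
    simpa only [hk s, one_smul, sub_self] using (hasDerivAt_comp_line (hf s)).fun_sub hid
  have hconst := is_const_of_deriv_eq_zero (fun s => (hderiv s).differentiableAt)
    (fun s => (hderiv s).deriv) t 0
  simpa [sub_eq_iff_eq_add] using hconst

lemma fderiv_line_eq_zero_of_bounded {f : E → ℝ} {k M : ℝ}
    (hf : ∀ s : ℝ, DifferentiableAt ℝ f (p + s • v))
    (hk : ∀ s : ℝ, fderiv ℝ f (p + s • v) v = k) (hM : ∀ s : ℝ, |f (p + s • v)| ≤ M) : k = 0 := by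
  by_contra hne
  have hgrowth := comp_line_eq_of_fderiv_eq hf hk ((2 * M + 1) / k)
  rw [smul_eq_mul, div_mul_cancel₀ _ hne] at hgrowth
  have hstart : -M ≤ f p := by simpa using (abs_le.1 (hM 0)).1
  linarith [(abs_le.1 (hM ((2 * M + 1) / k))).2]

variable {Ω : Set E} {f : E → F}

lemma apply_add_smul_eq_of_fderiv_eq_zero (hΩ : ∀ q ∈ Ω, ∀ s : ℝ, q + s • v ∈ Ω)
    (hf : ∀ q ∈ Ω, DifferentiableAt ℝ f q) (hv : ∀ q ∈ Ω, fderiv ℝ f q v = 0) (hp : p ∈ Ω)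
    (t : ℝ) : f (p + t • v) = f p := by
  simpa using comp_line_eq_of_fderiv_eq (fun s => hf _ (hΩ p hp s)) (fun s => hv _ (hΩ p hp s)) t

lemma fderiv_add_smul_eq_of_fderiv_eq_zero (hopen : IsOpen Ω)
    (hΩ : ∀ q ∈ Ω, ∀ s : ℝ, q + s • v ∈ Ω) (hf : ∀ q ∈ Ω, DifferentiableAt ℝ f q)
    (hv : ∀ q ∈ Ω, fderiv ℝ f q v = 0) (hp : p ∈ Ω) (t : ℝ) :
    fderiv ℝ f (p + t • v) = fderiv ℝ f p := by
  rw [← fderiv_comp_add_right]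
  exact EventuallyEq.fderiv_eq <| (hopen.eventually_mem hp).mono fun q hq =>
    apply_add_smul_eq_of_fderiv_eq_zero hΩ hf hv hq t

end Line

lemma eq_zero_of_bounded_of_divergence_eq {f g : ℝ × ℝ → ℝ} {f' g' : ℝ × ℝ → ℝ × ℝ →L[ℝ] ℝ}
    {k M : ℝ} (hf : ∀ x, HasFDerivAt f (f' x) x) (hg : ∀ x, HasFDerivAt g (g' x) x)
    (hdiv : ∀ x, f' x (1, 0) + g' x (0, 1) = k) (hfM : ∀ x, |f x| ≤ M) (hgM : ∀ x, |g x| ≤ M) :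
    k = 0 := by
  have hflux : ∀ R : ℝ, 0 < R → |k| * R ≤ 4 * M := by
    intro R hR
    have hcont : ∀ {h : ℝ × ℝ → ℝ} {h' : ℝ × ℝ → ℝ × ℝ →L[ℝ] ℝ},
        (∀ x, HasFDerivAt h (h' x) x) → Continuous h := fun hh =>
      continuous_iff_continuousAt.2 fun x => (hh x).continuousAt
    have hgauss := MeasureTheory.integral2_divergence_prod_of_hasFDerivAt f g f' g' 0 0 R R
      (hcont hf).continuousOn (hcont hg).continuousOn (fun x _ => hf x) (fun x _ => hg x)
      (by simpa only [hdiv] using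
        continuous_const.continuousOn.integrableOn_compact (isCompact_uIcc.prod isCompact_uIcc))
    simp only [hdiv, intervalIntegral.integral_const, smul_eq_mul, sub_zero] at hgauss
    have hside : ∀ h : ℝ → ℝ, (∀ s, |h s| ≤ M) → |∫ s in (0 : ℝ)..R, h s| ≤ M * R := fun h hh => by
      simpa [abs_of_pos hR] using
        intervalIntegral.norm_integral_le_of_norm_le_const (a := 0) (b := R)
          (f := h) (C := M) fun s _ => hh s
    have htop := abs_le.1 (hside (fun s => g (s, R)) fun s => hgM _)
    have hbottom := abs_le.1 (hside (fun s => g (s, 0)) fun s => hgM _)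
    have hright := abs_le.1 (hside (fun s => f (R, s)) fun s => hfM _)
    have hleft := abs_le.1 (hside (fun s => f (0, s)) fun s => hfM _)
    have htotal : |R * (R * k)| ≤ R * (4 * M) := by
      rw [hgauss, abs_le]
      constructor <;> linarith [htop.1, htop.2, hbottom.1, hbottom.2, hright.1, hright.2,
        hleft.1, hleft.2]
    rw [abs_mul, abs_mul, abs_of_pos hR, mul_comm R |k|] at htotal
    exact le_of_mul_le_mul_left htotal hR
  by_contra hne
  have hpos := abs_pos.2 hne
  have hM : 0 ≤ M := (abs_nonneg _).trans (hfM 0)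
  have hlarge := hflux ((4 * M + 1) / |k|) (by positivity)
  rw [mul_div_cancel₀ _ hpos.ne'] at hlarge
  linarith

lemma fderiv_apply_eq_sum_pd {n : ℕ} (f : (Fin n → ℝ) → ℝ) (p v : Fin n → ℝ) :
    fderiv ℝ f p v = ∑ j, v j * pd j f p := by
  conv_lhs => rw [pi_eq_sum_univ' v, map_sum]
  simp only [map_smul, smul_eq_mul, pd]

lemma hasFDerivAt_component {u : (Fin 3 → ℝ) → (Fin 3 → ℝ)} {p : Fin 3 → ℝ}
    (hu : DifferentiableAt ℝ u p) (k : Fin 3) :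
    HasFDerivAt (fun q => u q k) (fderiv ℝ (fun q => u q k) p) p :=
  (differentiableAt_pi.1 hu k).hasFDerivAt

lemma curl_vertical_eq_zero_of_bounded {u : (Fin 3 → ℝ) → (Fin 3 → ℝ)} {c k M : ℝ}
    (hu : ∀ p : Fin 3 → ℝ, p 2 = c → DifferentiableAt ℝ u p)
    (hk : ∀ p : Fin 3 → ℝ, p 2 = c → curl u p 2 = k)
    (hM : ∀ p : Fin 3 → ℝ, p 2 = c → ‖u p‖ ≤ M) : k = 0 := by
  let J : ℝ × ℝ →L[ℝ] (Fin 3 → ℝ) :=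
    ContinuousLinearMap.pi ![ContinuousLinearMap.fst ℝ ℝ ℝ, ContinuousLinearMap.snd ℝ ℝ ℝ, 0]
  let plane : ℝ × ℝ → Fin 3 → ℝ := fun x => J x + Pi.single 2 c
  have hplane : ∀ x, plane x 2 = c := fun x => by simp [plane, J]
  have hJ₀ : J (1, 0) = Pi.single 0 1 := by ext i; fin_cases i <;> simp [J]
  have hJ₁ : J (0, 1) = Pi.single 1 1 := by ext i; fin_cases i <;> simp [J]
  have hcomp : ∀ (j : Fin 3) (x : ℝ × ℝ), HasFDerivAt (fun x => u (plane x) j)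
      ((fderiv ℝ (fun q => u q j) (plane x)).comp J) x := fun j x =>
    (hasFDerivAt_component (hu _ (hplane x)) j).comp x (J.hasFDerivAt.add_const _)
  have hbound : ∀ (j : Fin 3) (x : ℝ × ℝ), |u (plane x) j| ≤ M := fun j x =>
    (norm_le_pi_norm (u (plane x)) j).trans (hM _ (hplane x))
  refine eq_zero_of_bounded_of_divergence_eq (hcomp 1) (fun x => (hcomp 0 x).neg) (fun x => ?_)
    (hbound 1) fun x => by simpa only [Pi.neg_apply, abs_neg] using hbound 0 x
  rw [neg_apply, ContinuousLinearMap.comp_apply, ContinuousLinearMap.comp_apply, hJ₀, hJ₁,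
    ← sub_eq_add_neg]
  exact hk _ (hplane x)

namespace IsSteadyEuler

variable {ρ g : ℝ} {Ω : Set (Fin 3 → ℝ)} {u : (Fin 3 → ℝ) → (Fin 3 → ℝ)}
  {P : (Fin 3 → ℝ) → ℝ} {p : Fin 3 → ℝ}

lemma differentiableAt_velocity (h : IsSteadyEuler ρ g Ω u P) (hΩ : IsOpen Ω) (hp : p ∈ Ω) :
    DifferentiableAt ℝ u p :=
  (h.contDiffOn_velocity.contDiffAt
    (mem_of_superset (hΩ.mem_nhds hp) subset_closure)).differentiableAt one_ne_zero

lemma differentiableAt_pressure (h : IsSteadyEuler ρ g Ω u P) (hΩ : IsOpen Ω) (hp : p ∈ Ω) :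
    DifferentiableAt ℝ P p :=
  (h.contDiffOn_pressure.contDiffAt
    (mem_of_superset (hΩ.mem_nhds hp) subset_closure)).differentiableAt one_ne_zero

end IsSteadyEuler

/-- The Bernoulli function (total head) `P / ρ + g z + |u|² / 2`. -/
noncomputable def bernoulliHead (ρ g : ℝ) (u : (Fin 3 → ℝ) → (Fin 3 → ℝ)) (P : (Fin 3 → ℝ) → ℝ)
    (p : Fin 3 → ℝ) : ℝ :=
  ρ⁻¹ * P p + g * p 2 + 2⁻¹ * (u p 0 ^ 2 + u p 1 ^ 2 + u p 2 ^ 2)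

lemma IsSteadyEuler.hasFDerivAt_bernoulliHead {ρ g : ℝ} {Ω : Set (Fin 3 → ℝ)}
    {u : (Fin 3 → ℝ) → (Fin 3 → ℝ)} {P : (Fin 3 → ℝ) → ℝ} {p : Fin 3 → ℝ}
    (h : IsSteadyEuler ρ g Ω u P) (hρ : ρ ≠ 0) (hΩ : IsOpen Ω) (hp : p ∈ Ω) :
    HasFDerivAt (bernoulliHead ρ g u P)
      (∑ j, crossProduct (u p) (curl u p) j •
        (ContinuousLinearMap.proj j : (Fin 3 → ℝ) →L[ℝ] ℝ)) p := by
  have hu := h.differentiableAt_velocity hΩ hp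
  have hP := (h.differentiableAt_pressure hΩ hp).hasFDerivAt
  have hkinetic := (((hasFDerivAt_component hu 0).pow 2).add
    ((hasFDerivAt_component hu 1).pow 2)).add ((hasFDerivAt_component hu 2).pow 2)
  refine (((hP.const_mul ρ⁻¹).add ((hasFDerivAt_apply (𝕜 := ℝ) 2 p).const_mul g)).add
    (hkinetic.const_mul 2⁻¹)).congr_fderiv ?_
  have momentum : ∀ k, pd k P p = ρ * (![0, 0, -g] : Fin 3 → ℝ) k
      - ρ * ∑ j, u p j * pd j (fun q => u q k) p := fun k => by
    rw [h.momentum p hp k]; ring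
  ext v
  simp only [add_apply, smul_apply, fderiv_apply_eq_sum_pd, momentum, Fin.sum_univ_three,
    ContinuousLinearMap.proj_apply, smul_eq_mul, curl, cross_apply, Matrix.cons_val, nsmul_eq_mul,
    Nat.cast_ofNat, Nat.add_one_sub_one, pow_one]
  field_simp
  ring

/-- The horizontal velocity component along `(a, b)`. -/
def axial (a b : ℝ) (u : (Fin 3 → ℝ) → (Fin 3 → ℝ)) (p : Fin 3 → ℝ) : ℝ := a * u p 0 + b * u p 1

/-- The horizontal velocity component along `(b, -a)`. -/
def transverse (a b : ℝ) (u : (Fin 3 → ℝ) → (Fin 3 → ℝ)) (p : Fin 3 → ℝ) : ℝ :=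
  b * u p 0 - a * u p 1

lemma velocity_eq {a b : ℝ} (hab : a ^ 2 + b ^ 2 = 1) (u : (Fin 3 → ℝ) → (Fin 3 → ℝ))
    (p : Fin 3 → ℝ) : u p = ![a * axial a b u p + b * transverse a b u p,
      b * axial a b u p - a * transverse a b u p, u p 2] := by
  ext i
  fin_cases i
  · simp only [axial, transverse, Fin.zero_eta, Matrix.cons_val_zero]
    linear_combination -u p 0 * hab
  · simp only [axial, transverse, Fin.mk_one, Matrix.cons_val_one, Matrix.cons_val_zero]
    linear_combination -u p 1 * hab
  · rfl

lemma hasFDerivAt_axial (a b : ℝ) {u : (Fin 3 → ℝ) → (Fin 3 → ℝ)} {p : Fin 3 → ℝ}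
    (hu : DifferentiableAt ℝ u p) :
    HasFDerivAt (axial a b u)
      (a • fderiv ℝ (fun q => u q 0) p + b • fderiv ℝ (fun q => u q 1) p) p :=
  ((hasFDerivAt_component hu 0).const_mul a).add ((hasFDerivAt_component hu 1).const_mul b)

lemma hasFDerivAt_transverse (a b : ℝ) {u : (Fin 3 → ℝ) → (Fin 3 → ℝ)} {p : Fin 3 → ℝ}
    (hu : DifferentiableAt ℝ u p) :
    HasFDerivAt (transverse a b u)
      (b • fderiv ℝ (fun q => u q 0) p - a • fderiv ℝ (fun q => u q 1) p) p :=
  ((hasFDerivAt_component hu 0).const_mul b).sub ((hasFDerivAt_component hu 1).const_mul a)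

/-- A steady flow in the open set `Ω` with constant nonzero vorticity `γ (a, b, 0)`, where `(a, b)`
is a unit vector. -/
structure IsHorizontalVorticityFlow (ρ g γ a b : ℝ) (Ω : Set (Fin 3 → ℝ))
    (u : (Fin 3 → ℝ) → (Fin 3 → ℝ)) (P : (Fin 3 → ℝ) → ℝ) : Prop where
  density_ne_zero : ρ ≠ 0
  vorticity_ne_zero : γ ≠ 0
  unit : a ^ 2 + b ^ 2 = 1
  isOpen : IsOpen Ω
  euler : IsSteadyEuler ρ g Ω u P
  curl_eq : ∀ p ∈ Ω, curl u p = γ • ![a, b, 0]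

namespace IsHorizontalVorticityFlow

variable {ρ g γ a b : ℝ} {Ω : Set (Fin 3 → ℝ)} {u : (Fin 3 → ℝ) → (Fin 3 → ℝ)}
  {P : (Fin 3 → ℝ) → ℝ} {p : Fin 3 → ℝ}

lemma differentiableAt_velocity (H : IsHorizontalVorticityFlow ρ g γ a b Ω u P) (hp : p ∈ Ω) :
    DifferentiableAt ℝ u p :=
  H.euler.differentiableAt_velocity H.isOpen hp

lemma differentiableAt_vertical (H : IsHorizontalVorticityFlow ρ g γ a b Ω u P) (hp : p ∈ Ω) :
    DifferentiableAt ℝ (fun q => u q 2) p :=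
  differentiableAt_pi.1 (H.differentiableAt_velocity hp) 2

lemma differentiableAt_axial (H : IsHorizontalVorticityFlow ρ g γ a b Ω u P) (hp : p ∈ Ω) :
    DifferentiableAt ℝ (axial a b u) p :=
  (hasFDerivAt_axial a b (H.differentiableAt_velocity hp)).differentiableAt

lemma differentiableAt_transverse (H : IsHorizontalVorticityFlow ρ g γ a b Ω u P) (hp : p ∈ Ω) :
    DifferentiableAt ℝ (transverse a b u) p :=
  (hasFDerivAt_transverse a b (H.differentiableAt_velocity hp)).differentiableAt

lemma hasFDerivAt_bernoulliHead (H : IsHorizontalVorticityFlow ρ g γ a b Ω u P) (hp : p ∈ Ω) :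
    HasFDerivAt (bernoulliHead ρ g u P)
      (γ • (u p 2 • (a • ContinuousLinearMap.proj 1 - b • ContinuousLinearMap.proj 0)
        + transverse a b u p • ContinuousLinearMap.proj 2 : (Fin 3 → ℝ) →L[ℝ] ℝ)) p := by
  refine (H.euler.hasFDerivAt_bernoulliHead H.density_ne_zero H.isOpen hp).congr_fderiv ?_
  ext v
  simp only [H.curl_eq p hp, Fin.sum_univ_three, add_apply, sub_apply, smul_apply,
    ContinuousLinearMap.proj_apply, smul_eq_mul, cross_apply, Pi.smul_apply, transverse,
    Matrix.cons_val]
  ring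

-- The Lamb vector is a gradient, so its derivative is symmetric; it has no component along `ω`.
lemma fderiv_lamb_axis (H : IsHorizontalVorticityFlow ρ g γ a b Ω u P) (hp : p ∈ Ω)
    (v : Fin 3 → ℝ) :
    fderiv ℝ (fun q => u q 2) p ![a, b, 0] * (a * v 1 - b * v 0)
      + fderiv ℝ (transverse a b u) p ![a, b, 0] * v 2 = 0 := by
  have hlamb := (((H.differentiableAt_vertical hp).hasFDerivAt.smul_const
      (a • ContinuousLinearMap.proj 1 - b • ContinuousLinearMap.proj 0 :
        (Fin 3 → ℝ) →L[ℝ] ℝ)).add ((H.differentiableAt_transverse hp).hasFDerivAt.smul_const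
      (ContinuousLinearMap.proj 2 : (Fin 3 → ℝ) →L[ℝ] ℝ))).const_smul γ
  have hhead := (H.isOpen.eventually_mem hp).mono fun q hq => H.hasFDerivAt_bernoulliHead hq
  have hsymm := second_derivative_symmetric_of_eventually hhead hlamb ![a, b, 0] v
  simp only [add_apply, sub_apply, smul_apply, ContinuousLinearMap.smulRight_apply,
    ContinuousLinearMap.proj_apply, smul_eq_mul, Matrix.cons_val] at hsymm
  apply mul_left_cancel₀ H.vorticity_ne_zero
  linear_combination hsymm

lemma fderiv_vertical_axis (H : IsHorizontalVorticityFlow ρ g γ a b Ω u P) (hp : p ∈ Ω) :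
    fderiv ℝ (fun q => u q 2) p ![a, b, 0] = 0 := by
  have h := H.fderiv_lamb_axis hp ![b, -a, 0]
  simp only [Matrix.cons_val] at h
  linear_combination -h - fderiv ℝ (fun q => u q 2) p ![a, b, 0] * H.unit

lemma fderiv_transverse_axis (H : IsHorizontalVorticityFlow ρ g γ a b Ω u P) (hp : p ∈ Ω) :
    fderiv ℝ (transverse a b u) p ![a, b, 0] = 0 := by
  simpa using H.fderiv_lamb_axis hp (Pi.single 2 1)

lemma curl_apply (H : IsHorizontalVorticityFlow ρ g γ a b Ω u P) (hp : p ∈ Ω) (i : Fin 3) :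
    curl u p i = γ * (![a, b, 0] : Fin 3 → ℝ) i := by
  rw [H.curl_eq p hp, Pi.smul_apply, smul_eq_mul]

lemma fderiv_axial (H : IsHorizontalVorticityFlow ρ g γ a b Ω u P) (hp : p ∈ Ω)
    (v : Fin 3 → ℝ) : fderiv ℝ (axial a b u) p v
      = (a * v 0 + b * v 1) * fderiv ℝ (axial a b u) p ![a, b, 0] := by
  have hu := H.differentiableAt_velocity hp
  have hw := H.fderiv_vertical_axis hp
  have hT := H.fderiv_transverse_axis hp
  have hω₀ := H.curl_apply hp 0
  have hω₁ := H.curl_apply hp 1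
  have hω₂ := H.curl_apply hp 2
  rw [(hasFDerivAt_transverse a b hu).fderiv] at hT
  rw [(hasFDerivAt_axial a b hu).fderiv]
  simp only [Fin.sum_univ_three, add_apply, sub_apply, smul_apply, smul_eq_mul, curl,
    fderiv_apply_eq_sum_pd, Matrix.cons_val] at hw hT hω₀ hω₁ hω₂ ⊢
  linear_combination v 2 * (a * hω₁ - b * hω₀ + hw)
    + (b * v 0 - a * v 1) * (hT + (a ^ 2 + b ^ 2) * hω₂)
    - (v 0 * (a * pd 0 (fun q => u q 0) p + b * pd 0 (fun q => u q 1) p)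
      + v 1 * (a * pd 1 (fun q => u q 0) p + b * pd 1 (fun q => u q 1) p)) * H.unit

lemma fderiv_axial_axis (H : IsHorizontalVorticityFlow ρ g γ a b Ω u P) (hp : p ∈ Ω) :
    fderiv ℝ (axial a b u) p ![a, b, 0] = -fderiv ℝ (fun q => u q 2) p (Pi.single 2 1)
      - fderiv ℝ (transverse a b u) p ![b, -a, 0] := by
  have hu := H.differentiableAt_velocity hp
  have hdiv := H.euler.incompressible p hp
  rw [(hasFDerivAt_axial a b hu).fderiv, (hasFDerivAt_transverse a b hu).fderiv]
  simp only [Fin.sum_univ_three, add_apply, sub_apply, smul_apply, smul_eq_mul,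
    fderiv_apply_eq_sum_pd, Matrix.cons_val, Pi.single_apply, Fin.reduceEq, if_true,
    if_false] at hdiv ⊢
  linear_combination hdiv
    + (pd 0 (fun q => u q 0) p + pd 1 (fun q => u q 1) p) * H.unit

lemma fderiv_transverse_vertical (H : IsHorizontalVorticityFlow ρ g γ a b Ω u P) (hp : p ∈ Ω) :
    fderiv ℝ (transverse a b u) p (Pi.single 2 1)
      = fderiv ℝ (fun q => u q 2) p ![b, -a, 0] + γ := by
  have hω₀ := H.curl_apply hp 0
  have hω₁ := H.curl_apply hp 1
  rw [(hasFDerivAt_transverse a b (H.differentiableAt_velocity hp)).fderiv]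
  simp only [Fin.sum_univ_three, sub_apply, smul_apply, smul_eq_mul, curl,
    fderiv_apply_eq_sum_pd, Matrix.cons_val, Pi.single_apply, Fin.reduceEq, if_true,
    if_false] at hω₀ hω₁ ⊢
  linear_combination b * hω₁ + a * hω₀ + γ * H.unit

end IsHorizontalVorticityFlow

/-- The region between the graphs of `lo` and `hi`. -/
def layer (lo hi : (Fin 2 → ℝ) → ℝ) : Set (Fin 3 → ℝ) :=
  {p | lo ![p 0, p 1] < p 2 ∧ p 2 < hi ![p 0, p 1]}

/-- The point at height `z` above the point `x` of the horizontal plane. -/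
def atHeight (x : Fin 2 → ℝ) (z : ℝ) : Fin 3 → ℝ := ![x 0, x 1, z]

lemma exists_eq_atHeight (p : Fin 3 → ℝ) : ∃ x z, p = atHeight x z :=
  ⟨![p 0, p 1], p 2, by ext i; fin_cases i <;> rfl⟩

lemma horizontal_atHeight (x : Fin 2 → ℝ) (z : ℝ) : ![atHeight x z 0, atHeight x z 1] = x := by
  ext i; fin_cases i <;> rfl

lemma atHeight_add_smul (x : Fin 2 → ℝ) (z t a b : ℝ) :
    atHeight x z + t • ![a, b, 0] = atHeight (x + t • ![a, b]) z := by
  ext i; fin_cases i <;> simp [atHeight]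

lemma hasDerivAt_atHeight (x : Fin 2 → ℝ) (z : ℝ) :
    HasDerivAt (atHeight x) (Pi.single 2 1) z := by
  rw [hasDerivAt_pi]
  intro i
  fin_cases i
  · exact hasDerivAt_const z (x 0)
  · exact hasDerivAt_const z (x 1)
  · exact hasDerivAt_id z

lemma continuous_atHeight (x : Fin 2 → ℝ) : Continuous (atHeight x) :=
  continuous_iff_continuousAt.2 fun z => (hasDerivAt_atHeight x z).continuousAt

lemma hasDerivAt_comp_atHeight {f : (Fin 3 → ℝ) → ℝ} {x : Fin 2 → ℝ} {z : ℝ}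
    (hf : DifferentiableAt ℝ f (atHeight x z)) :
    HasDerivAt (fun z => f (atHeight x z)) (pd 2 f (atHeight x z)) z :=
  hf.hasFDerivAt.comp_hasDerivAt z (hasDerivAt_atHeight x z)

lemma atHeight_mem_layer {lo hi : (Fin 2 → ℝ) → ℝ} {x : Fin 2 → ℝ} {z : ℝ} :
    atHeight x z ∈ layer lo hi ↔ z ∈ Ioo (lo x) (hi x) := by
  rw [layer, mem_ofPred_eq, horizontal_atHeight]
  rfl

/-- The open horizontal slab `c₁ < z < c₂`. -/
def slab (c₁ c₂ : ℝ) : Set (Fin 3 → ℝ) := {p | p 2 ∈ Ioo c₁ c₂}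

lemma isOpen_slab (c₁ c₂ : ℝ) : IsOpen (slab c₁ c₂) := isOpen_Ioo.preimage (continuous_apply 2)

lemma convex_slab (c₁ c₂ : ℝ) : Convex ℝ (slab c₁ c₂) :=
  (convex_Ioo c₁ c₂).linear_preimage (LinearMap.proj 2 : (Fin 3 → ℝ) →ₗ[ℝ] ℝ)

lemma add_smul_mem_slab {c₁ c₂ : ℝ} (a b : ℝ) : ∀ p ∈ slab c₁ c₂, ∀ t : ℝ,
    p + t • ![a, b, 0] ∈ slab c₁ c₂ := fun p hp t => by
  have hz : (p + t • ![a, b, 0]) 2 = p 2 := by rw [Pi.add_apply]; simp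
  rwa [slab, mem_ofPred_eq, hz]

/-- The graphs of the continuous functions `lo` and `hi` are separated by a slab, on which flows in
`layer lo hi` can be followed along whole horizontal lines. -/
structure SlabSeparated (lo hi : (Fin 2 → ℝ) → ℝ) : Prop where
  continuous_lo : Continuous lo
  continuous_hi : Continuous hi
  exists_slab : ∃ c₁ c₂, c₁ < c₂ ∧ ∀ x, lo x ≤ c₁ ∧ c₂ ≤ hi x

lemma slab_subset_layer {lo hi : (Fin 2 → ℝ) → ℝ} {c₁ c₂ : ℝ}
    (hc : ∀ x, lo x ≤ c₁ ∧ c₂ ≤ hi x) : slab c₁ c₂ ⊆ layer lo hi := fun _ hp =>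
  ⟨(hc _).1.trans_lt hp.1, hp.2.trans_le (hc _).2⟩

namespace SlabSeparated

variable {lo hi : (Fin 2 → ℝ) → ℝ} {x x' : Fin 2 → ℝ} {z : ℝ}

lemma isOpen_layer (hL : SlabSeparated lo hi) : IsOpen (layer lo hi) :=
  have hπ : Continuous fun p : Fin 3 → ℝ => ![p 0, p 1] := by fun_prop
  (isOpen_lt (hL.continuous_lo.comp hπ) (continuous_apply 2)).inter
    (isOpen_lt (continuous_apply 2) (hL.continuous_hi.comp hπ))

lemma lo_lt_hi (hL : SlabSeparated lo hi) (x x' : Fin 2 → ℝ) : lo x < hi x' := by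
  obtain ⟨c₁, c₂, hc, h⟩ := hL.exists_slab
  exact (h x).1.trans_lt (hc.trans_le (h x').2)

lemma max_lt_min (hL : SlabSeparated lo hi) (x x' : Fin 2 → ℝ) :
    max (lo x) (lo x') < min (hi x) (hi x') :=
  max_lt (lt_min (hL.lo_lt_hi x x) (hL.lo_lt_hi x x'))
    (lt_min (hL.lo_lt_hi x' x) (hL.lo_lt_hi x' x'))

lemma atHeight_mem_closure (hL : SlabSeparated lo hi) :
    atHeight x z ∈ closure (layer lo hi) ↔ z ∈ Icc (lo x) (hi x) := by
  constructor
  · have hπ : Continuous fun p : Fin 3 → ℝ => ![p 0, p 1] := by fun_prop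
    have hclosed : IsClosed {p : Fin 3 → ℝ | lo ![p 0, p 1] ≤ p 2 ∧ p 2 ≤ hi ![p 0, p 1]} :=
      (isClosed_le (hL.continuous_lo.comp hπ) (continuous_apply 2)).inter
        (isClosed_le (continuous_apply 2) (hL.continuous_hi.comp hπ))
    intro h
    have hbounds := hclosed.closure_subset_iff.2
      (fun p (hp : p ∈ layer lo hi) => ⟨hp.1.le, hp.2.le⟩) h
    rwa [mem_ofPred_eq, horizontal_atHeight] at hbounds
  · intro h
    rw [← closure_Ioo (hL.lo_lt_hi x x).ne] at h
    exact map_mem_closure (continuous_atHeight x) h fun z hz => atHeight_mem_layer.2 hz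

lemma eq_atHeight_of_closure (hL : SlabSeparated lo hi) {F : Type*} [TopologicalSpace F]
    [T2Space F] {f : (Fin 3 → ℝ) → F} (hf : ContinuousOn f (closure (layer lo hi)))
    (hinv : ∀ z ∈ Ioo (lo x) (hi x) ∩ Ioo (lo x') (hi x'), f (atHeight x z) = f (atHeight x' z))
    (hz : z ∈ Icc (lo x) (hi x) ∩ Icc (lo x') (hi x')) :
    f (atHeight x z) = f (atHeight x' z) := by
  have hcont : ∀ y, ContinuousOn (fun z => f (atHeight y z)) (Icc (lo y) (hi y)) := fun y =>
    hf.comp (continuous_atHeight y).continuousOn fun z hz => hL.atHeight_mem_closure.2 hz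
  refine EqOn.of_subset_closure hinv ((hcont x).mono inter_subset_left)
    ((hcont x').mono inter_subset_right)
    (inter_subset_inter Ioo_subset_Icc_self Ioo_subset_Icc_self) ?_ hz
  rw [Ioo_inter_Ioo, closure_Ioo (hL.max_lt_min x x').ne, Icc_inter_Icc]

lemma hasDerivWithinAt_atHeight (hL : SlabSeparated lo hi) {f : (Fin 3 → ℝ) → ℝ}
    (hf : DifferentiableOn ℝ f (closure (layer lo hi))) (hz : z ∈ Icc (lo x) (hi x)) :
    HasDerivWithinAt (fun z => f (atHeight x z))
      (pdWithin (closure (layer lo hi)) 2 f (atHeight x z)) (Icc (lo x) (hi x)) z :=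
  (hf _ (hL.atHeight_mem_closure.2 hz)).hasFDerivWithinAt.comp_hasDerivWithinAt z
    (hasDerivAt_atHeight x z).hasDerivWithinAt fun _ h => hL.atHeight_mem_closure.2 h

lemma pdWithin_atHeight_eq (hL : SlabSeparated lo hi) {f : (Fin 3 → ℝ) → ℝ}
    (hf : DifferentiableOn ℝ f (closure (layer lo hi)))
    (hinv : ∀ z ∈ Icc (lo x) (hi x) ∩ Icc (lo x') (hi x'), f (atHeight x z) = f (atHeight x' z))
    (hz : z ∈ Icc (lo x) (hi x) ∩ Icc (lo x') (hi x')) :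
    pdWithin (closure (layer lo hi)) 2 f (atHeight x z)
      = pdWithin (closure (layer lo hi)) 2 f (atHeight x' z) := by
  have hunique : UniqueDiffOn ℝ (Icc (lo x) (hi x) ∩ Icc (lo x') (hi x')) := by
    rw [Icc_inter_Icc]
    exact uniqueDiffOn_Icc (hL.max_lt_min x x')
  refine (hunique z hz).eq_deriv _
    ((hL.hasDerivWithinAt_atHeight hf hz.1).mono inter_subset_left) ?_
  exact ((hL.hasDerivWithinAt_atHeight hf hz.2).mono inter_subset_right).congr_of_mem hinv hz

end SlabSeparated

/-- The vertical plane through `atHeight x 0` orthogonal to `(a, b, 0)`, with the complex coordinate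
whose imaginary part is the height. -/
noncomputable def verticalSlice (a b : ℝ) (x : Fin 2 → ℝ) (ζ : ℂ) : Fin 3 → ℝ :=
  atHeight (x + ζ.re • ![b, -a]) ζ.im

lemma verticalSlice_mul_I (a b : ℝ) (x : Fin 2 → ℝ) (z : ℝ) :
    verticalSlice a b x (z * Complex.I) = atHeight x z := by
  simp [verticalSlice]

lemma verticalSlice_add_smul (a b : ℝ) (x : Fin 2 → ℝ) (t : ℝ) (ζ : ℂ) :
    verticalSlice a b (x + t • ![a, b]) ζ = verticalSlice a b x ζ + t • ![a, b, 0] := by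
  rw [verticalSlice, verticalSlice, atHeight_add_smul, add_right_comm]

lemma hasFDerivAt_verticalSlice (a b : ℝ) (x : Fin 2 → ℝ) (ζ : ℂ) :
    HasFDerivAt (verticalSlice a b x)
      (Complex.reCLM.smulRight ![b, -a, 0] + Complex.imCLM.smulRight (Pi.single 2 1)) ζ := by
  have haffine : verticalSlice a b x = fun ζ => (Complex.reCLM.smulRight ![b, -a, 0]
      + Complex.imCLM.smulRight (Pi.single 2 1 : Fin 3 → ℝ)) ζ + atHeight x 0 := by
    funext ζ i
    simp only [verticalSlice, atHeight, add_apply, ContinuousLinearMap.smulRight_apply,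
      Pi.add_apply, Pi.smul_apply, Complex.reCLM_apply, Complex.imCLM_apply]
    fin_cases i <;> simp [add_comm]
  rw [haffine]
  exact (ContinuousLinearMap.hasFDerivAt _).add_const _

/-- The complex velocity in a vertical slice, from which the shear flow with vorticity `γ` has been
subtracted so that it is holomorphic. -/
noncomputable def complexVelocity (a b γ : ℝ) (u : (Fin 3 → ℝ) → (Fin 3 → ℝ)) (x : Fin 2 → ℝ)
    (ζ : ℂ) : ℂ :=
  ((transverse a b u (verticalSlice a b x ζ) - γ * ζ.im : ℝ) : ℂ)
    - (u (verticalSlice a b x ζ) 2 : ℂ) * Complex.I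

lemma abs_axial_le {a b M : ℝ} {u : (Fin 3 → ℝ) → (Fin 3 → ℝ)} {p : Fin 3 → ℝ}
    (hM : ‖u p‖ ≤ M) : |axial a b u p| ≤ (|a| + |b|) * M := by
  have hcoord : ∀ i, |u p i| ≤ M := fun i => (norm_le_pi_norm (u p) i).trans hM
  calc |axial a b u p| ≤ |a| * |u p 0| + |b| * |u p 1| := by
        simpa only [axial, abs_mul] using abs_add_le (a * u p 0) (b * u p 1)
    _ ≤ |a| * M + |b| * M := by gcongr <;> exact hcoord _
    _ = (|a| + |b|) * M := by ring

namespace IsHorizontalVorticityFlow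

section OpenSet

variable {ρ g γ a b c₁ c₂ M : ℝ} {Ω : Set (Fin 3 → ℝ)} {u : (Fin 3 → ℝ) → (Fin 3 → ℝ)}
  {P : (Fin 3 → ℝ) → ℝ} {p : Fin 3 → ℝ}

lemma mono {Ω' : Set (Fin 3 → ℝ)} (H : IsHorizontalVorticityFlow ρ g γ a b Ω u P)
    (hsub : Ω' ⊆ Ω) (hΩ' : IsOpen Ω') : IsHorizontalVorticityFlow ρ g γ a b Ω' u P where
  density_ne_zero := H.density_ne_zero
  vorticity_ne_zero := H.vorticity_ne_zero
  unit := H.unit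
  isOpen := hΩ'
  euler := {
    contDiffOn_velocity := H.euler.contDiffOn_velocity.mono (closure_mono hsub)
    contDiffOn_pressure := H.euler.contDiffOn_pressure.mono (closure_mono hsub)
    momentum := fun p hp => H.euler.momentum p (hsub hp)
    incompressible := fun p hp => H.euler.incompressible p (hsub hp) }
  curl_eq := fun p hp => H.curl_eq p (hsub hp)

-- Along the vorticity the derivative of `axial a b u` is constant, by incompressibility, so a
-- bounded flow makes it vanish.
lemma fderiv_axial_eq_zero_of_slab (H : IsHorizontalVorticityFlow ρ g γ a b (slab c₁ c₂) u P)
    (hM : ∀ p ∈ slab c₁ c₂, ‖u p‖ ≤ M) (hp : p ∈ slab c₁ c₂) :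
    fderiv ℝ (axial a b u) p = 0 := by
  have hslab := add_smul_mem_slab (c₁ := c₁) (c₂ := c₂) a b
  have hw := fun t => fderiv_add_smul_eq_of_fderiv_eq_zero (isOpen_slab c₁ c₂) hslab
    (fun _ => H.differentiableAt_vertical) (fun _ => H.fderiv_vertical_axis) hp t
  have hT := fun t => fderiv_add_smul_eq_of_fderiv_eq_zero (isOpen_slab c₁ c₂) hslab
    (fun _ => H.differentiableAt_transverse) (fun _ => H.fderiv_transverse_axis) hp t
  have haxis : fderiv ℝ (axial a b u) p ![a, b, 0] = 0 := by
    refine fderiv_line_eq_zero_of_bounded (fun s => H.differentiableAt_axial (hslab p hp s))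
      (fun s => ?_) (fun s => abs_axial_le (hM _ (hslab p hp s)))
    rw [H.fderiv_axial_axis (hslab p hp s), H.fderiv_axial_axis hp, hw, hT]
  ext v
  rw [H.fderiv_axial hp, haxis, mul_zero, zero_apply]

lemma differentiableAt_complexVelocity (H : IsHorizontalVorticityFlow ρ g γ a b Ω u P)
    (haxial : ∀ p ∈ Ω, fderiv ℝ (axial a b u) p ![a, b, 0] = 0) {x : Fin 2 → ℝ} {ζ : ℂ}
    (hζ : verticalSlice a b x ζ ∈ Ω) :
    DifferentiableAt ℂ (complexVelocity a b γ u x) ζ := by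
  have hS := hasFDerivAt_verticalSlice a b x ζ
  have hT := (H.differentiableAt_transverse hζ).hasFDerivAt.comp ζ hS
  have hw := (H.differentiableAt_vertical hζ).hasFDerivAt.comp ζ hS
  have hF : HasFDerivAt (complexVelocity a b γ u x) _ ζ :=
    (Complex.ofRealCLM.hasFDerivAt.comp ζ (hT.sub (Complex.imCLM.hasFDerivAt.const_mul γ))).sub
      ((Complex.ofRealCLM.hasFDerivAt.comp ζ hw).mul_const Complex.I)
  have hdivergence := (H.fderiv_axial_axis hζ).symm.trans (haxial _ hζ)
  have hvorticity := H.fderiv_transverse_vertical hζ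
  refine differentiableAt_complex_iff_differentiableAt_real.2 ⟨hF.differentiableAt, ?_⟩
  rw [hF.fderiv]
  apply Complex.ext <;>
  · simp only [add_apply, sub_apply, smul_apply, ContinuousLinearMap.comp_apply,
      ContinuousLinearMap.smulRight_apply, Complex.reCLM_apply, Complex.imCLM_apply,
      Complex.ofRealCLM_apply, smul_eq_mul, Complex.sub_re, Complex.sub_im, Complex.mul_re,
      Complex.mul_im, Complex.I_re, Complex.I_im, Complex.one_re, Complex.one_im,
      Complex.ofReal_re, Complex.ofReal_im, zero_smul, one_smul, zero_add, add_zero]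
    linarith

lemma analyticAt_complexVelocity (H : IsHorizontalVorticityFlow ρ g γ a b Ω u P)
    (haxial : ∀ p ∈ Ω, fderiv ℝ (axial a b u) p ![a, b, 0] = 0) {x : Fin 2 → ℝ} {ζ : ℂ}
    (hζ : verticalSlice a b x ζ ∈ Ω) :
    AnalyticAt ℂ (complexVelocity a b γ u x) ζ := by
  have hcont : Continuous (verticalSlice a b x) :=
    continuous_iff_continuousAt.2 fun ζ => (hasFDerivAt_verticalSlice a b x ζ).continuousAt
  exact DifferentiableOn.analyticAt
    (fun ξ hξ => (H.differentiableAt_complexVelocity haxial hξ).differentiableWithinAt)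
    ((H.isOpen.preimage hcont).mem_nhds hζ)

end OpenSet

section Layer

variable {ρ g γ a b M : ℝ} {lo hi : (Fin 2 → ℝ) → ℝ} {u : (Fin 3 → ℝ) → (Fin 3 → ℝ)}
  {P : (Fin 3 → ℝ) → ℝ}

lemma exists_axial_eq (H : IsHorizontalVorticityFlow ρ g γ a b (layer lo hi) u P)
    (hL : SlabSeparated lo hi) (hM : ∀ p ∈ layer lo hi, ‖u p‖ ≤ M) :
    ∃ V : ℝ, ∀ p ∈ layer lo hi, axial a b u p = V := by
  obtain ⟨c₁, c₂, hc, hbounds⟩ := hL.exists_slab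
  have hslab := slab_subset_layer hbounds
  have hgrad : EqOn (fderiv ℝ (axial a b u)) 0 (slab c₁ c₂) := fun p hp =>
    (H.mono hslab (isOpen_slab c₁ c₂)).fderiv_axial_eq_zero_of_slab
      (fun q hq => hM q (hslab hq)) hp
  obtain ⟨c, hcI⟩ := nonempty_Ioo.2 hc
  refine ⟨axial a b u (atHeight 0 c), fun p hp => ?_⟩
  obtain ⟨x, z, rfl⟩ := exists_eq_atHeight p
  have hline : ∀ z ∈ Ioo (lo x) (hi x),
      HasDerivAt (fun z => axial a b u (atHeight x z)) 0 z := fun z hz => by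
    have hz' := atHeight_mem_layer.2 hz
    have hvertical : pd 2 (axial a b u) (atHeight x z) = 0 := by
      simpa [pd] using H.fderiv_axial hz' (Pi.single 2 1)
    exact hvertical ▸ hasDerivAt_comp_atHeight (H.differentiableAt_axial hz')
  calc axial a b u (atHeight x z) = axial a b u (atHeight x c) :=
        isOpen_Ioo.is_const_of_deriv_eq_zero isPreconnected_Ioo
          (fun z hz => (hline z hz).differentiableAt.differentiableWithinAt)
          (fun z hz => (hline z hz).deriv) (atHeight_mem_layer.1 hp)
          (atHeight_mem_layer.1 (hslab (a := atHeight x c) hcI))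
    _ = axial a b u (atHeight 0 c) :=
        (isOpen_slab c₁ c₂).is_const_of_fderiv_eq_zero (convex_slab c₁ c₂).isPreconnected
          (fun q hq => (H.differentiableAt_axial (hslab hq)).differentiableWithinAt) hgrad
          (x := atHeight x c) (y := atHeight 0 c) hcI hcI

lemma fderiv_axial_axis_eq_zero (H : IsHorizontalVorticityFlow ρ g γ a b (layer lo hi) u P)
    (hL : SlabSeparated lo hi) (hM : ∀ p ∈ layer lo hi, ‖u p‖ ≤ M) :
    ∀ p ∈ layer lo hi, fderiv ℝ (axial a b u) p ![a, b, 0] = 0 := by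
  obtain ⟨V, hV⟩ := H.exists_axial_eq hL hM
  intro p hp
  have hconst : axial a b u =ᶠ[𝓝 p] fun _ => V := mem_of_superset (H.isOpen.mem_nhds hp) hV
  rw [hconst.fderiv_eq, fderiv_const_apply, zero_apply]

-- The points at height `z` above `x` and `x'` need not be joined by a segment in the layer, but the
-- two columns meet a common slab, from which the identity theorem propagates upwards and downwards.
lemma complexVelocity_eq (H : IsHorizontalVorticityFlow ρ g γ a b (layer lo hi) u P)
    (hL : SlabSeparated lo hi) (hM : ∀ p ∈ layer lo hi, ‖u p‖ ≤ M) {x x' : Fin 2 → ℝ} {t z : ℝ}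
    (hx' : x' = x + t • ![a, b]) (hz : z ∈ Ioo (lo x) (hi x) ∩ Ioo (lo x') (hi x')) :
    complexVelocity a b γ u x' (z * Complex.I) = complexVelocity a b γ u x (z * Complex.I) := by
  obtain ⟨c₁, c₂, hc, hbounds⟩ := hL.exists_slab
  have hslab := slab_subset_layer hbounds
  set column : Set ℂ :=
    (fun z : ℝ => z * Complex.I) '' (Ioo (lo x) (hi x) ∩ Ioo (lo x') (hi x'))
  have hanalytic : ∀ y : Fin 2 → ℝ, (∀ z ∈ Ioo (lo x) (hi x) ∩ Ioo (lo x') (hi x'),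
      z ∈ Ioo (lo y) (hi y)) → AnalyticOnNhd ℂ (complexVelocity a b γ u y) column := by
    rintro y hy _ ⟨z, hz, rfl⟩
    refine H.analyticAt_complexVelocity (H.fderiv_axial_axis_eq_zero hL hM) ?_
    rw [verticalSlice_mul_I]
    exact atHeight_mem_layer.2 (hy z hz)
  have hconn : IsPreconnected column :=
    (ordConnected_Ioo.inter ordConnected_Ioo).isPreconnected.image _ (by fun_prop)
  obtain ⟨c, hcI⟩ := nonempty_Ioo.2 hc
  have hnear : complexVelocity a b γ u x' =ᶠ[𝓝 (c * Complex.I)] complexVelocity a b γ u x := by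
    have hheight : ∀ᶠ ζ : ℂ in 𝓝 (c * Complex.I), ζ.im ∈ Ioo c₁ c₂ :=
      Complex.continuous_im.continuousAt.eventually (isOpen_Ioo.mem_nhds (by simpa using hcI))
    filter_upwards [hheight] with ζ hζ
    have hζ' : verticalSlice a b x ζ ∈ slab c₁ c₂ := hζ
    simp only [complexVelocity, hx', verticalSlice_add_smul]
    rw [apply_add_smul_eq_of_fderiv_eq_zero (add_smul_mem_slab a b)
        (fun p hp => H.differentiableAt_transverse (hslab hp))
        (fun p hp => H.fderiv_transverse_axis (hslab hp)) hζ',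
      apply_add_smul_eq_of_fderiv_eq_zero (f := fun q => u q 2) (add_smul_mem_slab a b)
        (fun p hp => H.differentiableAt_vertical (hslab hp))
        (fun p hp => H.fderiv_vertical_axis (hslab hp)) hζ']
  have hcommon : c ∈ Ioo (lo x) (hi x) ∩ Ioo (lo x') (hi x') :=
    ⟨Ioo_subset_Ioo (hbounds x).1 (hbounds x).2 hcI,
      Ioo_subset_Ioo (hbounds x').1 (hbounds x').2 hcI⟩
  exact (hanalytic x' fun _ h => h.2).eqOn_of_preconnected_of_eventuallyEq
    (hanalytic x fun _ h => h.1) hconn (mem_image_of_mem _ hcommon) hnear (mem_image_of_mem _ hz)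

end Layer

variable {ρ g γ a b M t z : ℝ} {lo hi : (Fin 2 → ℝ) → ℝ} {u : (Fin 3 → ℝ) → (Fin 3 → ℝ)}
  {P : (Fin 3 → ℝ) → ℝ} {x x' : Fin 2 → ℝ}

lemma velocity_atHeight_eq (H : IsHorizontalVorticityFlow ρ g γ a b (layer lo hi) u P)
    (hL : SlabSeparated lo hi) (hM : ∀ p ∈ layer lo hi, ‖u p‖ ≤ M) (hx' : x' = x + t • ![a, b])
    (hz : z ∈ Ioo (lo x) (hi x) ∩ Ioo (lo x') (hi x')) :
    u (atHeight x z) = u (atHeight x' z) := by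
  obtain ⟨V, hV⟩ := H.exists_axial_eq hL hM
  have hslice := H.complexVelocity_eq hL hM hx' hz
  simp only [complexVelocity, verticalSlice_mul_I, Complex.ext_iff, Complex.sub_re, Complex.sub_im,
    Complex.mul_re, Complex.mul_im, Complex.ofReal_re, Complex.ofReal_im, Complex.I_re,
    Complex.I_im] at hslice
  have htransverse : transverse a b u (atHeight x z) = transverse a b u (atHeight x' z) := by
    linarith [hslice.1]
  have hvertical : u (atHeight x z) 2 = u (atHeight x' z) 2 := by linarith [hslice.2]
  rw [velocity_eq H.unit u (atHeight x z), velocity_eq H.unit u (atHeight x' z), htransverse,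
    hvertical, hV _ (atHeight_mem_layer.2 hz.1), hV _ (atHeight_mem_layer.2 hz.2)]

lemma hasDerivAt_bernoulliHead_atHeight
    (H : IsHorizontalVorticityFlow ρ g γ a b (layer lo hi) u P) (hz : z ∈ Ioo (lo x) (hi x)) :
    HasDerivAt (fun z => bernoulliHead ρ g u P (atHeight x z))
      (γ * transverse a b u (atHeight x z)) z := by
  refine ((H.hasFDerivAt_bernoulliHead (atHeight_mem_layer.2 hz)).comp_hasDerivAt z
    (hasDerivAt_atHeight x z)).congr_deriv ?_
  simp

lemma bernoulliHead_atHeight_eq_of_slab {c₁ c₂ : ℝ}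
    (H : IsHorizontalVorticityFlow ρ g γ a b (slab c₁ c₂) u P) (hx' : x' = x + t • ![a, b])
    (hz : z ∈ Ioo c₁ c₂) :
    bernoulliHead ρ g u P (atHeight x z) = bernoulliHead ρ g u P (atHeight x' z) := by
  rw [hx', ← atHeight_add_smul]
  refine (apply_add_smul_eq_of_fderiv_eq_zero (add_smul_mem_slab a b)
    (fun p hp => (H.hasFDerivAt_bernoulliHead hp).differentiableAt) (fun p hp => ?_) hz t).symm
  rw [(H.hasFDerivAt_bernoulliHead hp).fderiv]
  simp [mul_comm a b]

lemma bernoulliHead_atHeight_eq (H : IsHorizontalVorticityFlow ρ g γ a b (layer lo hi) u P)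
    (hL : SlabSeparated lo hi) (hM : ∀ p ∈ layer lo hi, ‖u p‖ ≤ M) (hx' : x' = x + t • ![a, b])
    (hz : z ∈ Ioo (lo x) (hi x) ∩ Ioo (lo x') (hi x')) :
    bernoulliHead ρ g u P (atHeight x z) = bernoulliHead ρ g u P (atHeight x' z) := by
  obtain ⟨c₁, c₂, hc, hbounds⟩ := hL.exists_slab
  obtain ⟨c, hcI⟩ := nonempty_Ioo.2 hc
  have hc' : c ∈ Ioo (lo x) (hi x) ∩ Ioo (lo x') (hi x') :=
    ⟨Ioo_subset_Ioo (hbounds x).1 (hbounds x).2 hcI,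
      Ioo_subset_Ioo (hbounds x').1 (hbounds x').2 hcI⟩
  have hderiv : ∀ z ∈ Ioo (lo x) (hi x) ∩ Ioo (lo x') (hi x'),
      HasDerivAt (fun z => bernoulliHead ρ g u P (atHeight x z)
        - bernoulliHead ρ g u P (atHeight x' z)) 0 z := fun z hz => by
    have hdiff := (H.hasDerivAt_bernoulliHead_atHeight hz.1).fun_sub
      (H.hasDerivAt_bernoulliHead_atHeight hz.2)
    simpa only [transverse, H.velocity_atHeight_eq hL hM hx' hz, sub_self] using hdiff
  have hconst := (isOpen_Ioo.inter isOpen_Ioo).is_const_of_deriv_eq_zero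
    (ordConnected_Ioo.inter ordConnected_Ioo).isPreconnected
    (fun z hz => (hderiv z hz).differentiableAt.differentiableWithinAt)
    (fun z hz => (hderiv z hz).deriv) hz hc'
  have hslab := (H.mono (slab_subset_layer hbounds)
    (isOpen_slab c₁ c₂)).bernoulliHead_atHeight_eq_of_slab hx' hcI
  simpa only [hslab, sub_self, sub_eq_zero] using hconst

lemma pressure_atHeight_eq (H : IsHorizontalVorticityFlow ρ g γ a b (layer lo hi) u P)
    (hL : SlabSeparated lo hi) (hM : ∀ p ∈ layer lo hi, ‖u p‖ ≤ M) (hx' : x' = x + t • ![a, b])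
    (hz : z ∈ Ioo (lo x) (hi x) ∩ Ioo (lo x') (hi x')) :
    P (atHeight x z) = P (atHeight x' z) := by
  have hhead := H.bernoulliHead_atHeight_eq hL hM hx' hz
  have hheight : ∀ y, atHeight y z 2 = z := fun _ => rfl
  rw [bernoulliHead, bernoulliHead, H.velocity_atHeight_eq hL hM hx' hz, hheight, hheight] at hhead
  exact mul_left_cancel₀ (inv_ne_zero H.density_ne_zero) (by linarith)

lemma pressure_atHeight_eq_of_mem_Icc
    (H : IsHorizontalVorticityFlow ρ g γ a b (layer lo hi) u P) (hL : SlabSeparated lo hi)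
    (hM : ∀ p ∈ layer lo hi, ‖u p‖ ≤ M) (hx' : x' = x + t • ![a, b])
    (hz : z ∈ Icc (lo x) (hi x) ∩ Icc (lo x') (hi x')) : P (atHeight x z) = P (atHeight x' z) :=
  hL.eq_atHeight_of_closure H.euler.contDiffOn_pressure.continuousOn
    (fun _ => H.pressure_atHeight_eq hL hM hx') hz

lemma isTwoDimensionalFlow (H : IsHorizontalVorticityFlow ρ g γ a b (layer lo hi) u P)
    (hL : SlabSeparated lo hi) (hM : ∀ p ∈ layer lo hi, ‖u p‖ ≤ M) :
    IsTwoDimensionalFlow ![a, b, 0] (closure (layer lo hi)) u P := by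
  have hu := H.euler.contDiffOn_velocity.continuousOn
  refine ⟨fun p hp t hpt => ?_, ?_⟩
  · obtain ⟨x, z, rfl⟩ := exists_eq_atHeight p
    rw [atHeight_add_smul] at hpt ⊢
    have hz := And.intro (hL.atHeight_mem_closure.1 hp) (hL.atHeight_mem_closure.1 hpt)
    exact ⟨(hL.eq_atHeight_of_closure hu (fun _ => H.velocity_atHeight_eq hL hM rfl) hz).symm,
      (H.pressure_atHeight_eq_of_mem_Icc hL hM rfl hz).symm⟩
  · obtain ⟨V, hV⟩ := H.exists_axial_eq hL hM
    have haxial : ∀ p, u p ⬝ᵥ ![a, b, 0] = axial a b u p := fun p => by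
      simp [dotProduct, Fin.sum_univ_three, axial, mul_comm]
    refine ⟨V, fun p hp => (haxial p).trans ?_⟩
    refine EqOn.of_subset_closure (g := fun _ => V) hV ?_ continuousOn_const subset_closure
      Subset.rfl hp
    exact ((continuousOn_pi.1 hu 0).const_mul a).add ((continuousOn_pi.1 hu 1).const_mul b)

lemma pdWithin_pressure_atHeight_eq
    (H : IsHorizontalVorticityFlow ρ g γ a b (layer lo hi) u P) (hL : SlabSeparated lo hi)
    (hM : ∀ p ∈ layer lo hi, ‖u p‖ ≤ M) (hx' : x' = x + t • ![a, b])
    (hz : z ∈ Icc (lo x) (hi x) ∩ Icc (lo x') (hi x')) :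
    pdWithin (closure (layer lo hi)) 2 P (atHeight x z)
      = pdWithin (closure (layer lo hi)) 2 P (atHeight x' z) :=
  hL.pdWithin_atHeight_eq (H.euler.contDiffOn_pressure.differentiableOn one_ne_zero)
    (fun _ => H.pressure_atHeight_eq_of_mem_Icc hL hM hx') hz

end IsHorizontalVorticityFlow

section EllipticComparison

variable {E : Type*} [NormedAddCommGroup E] [NormedSpace ℝ E]

lemma fderiv_eq_zero_and_hessian_nonpos_of_max {f : E → ℝ} {f' : E → E →L[ℝ] ℝ}
    {f'' : E →L[ℝ] E →L[ℝ] ℝ} {x : E} (hf : ∀ y, HasFDerivAt f (f' y) y)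
    (hf' : HasFDerivAt f' f'' x) (hmax : ∀ y, f y ≤ f x) : f' x = 0 ∧ ∀ v, f'' v v ≤ 0 := by
  have hgrad : f' x = 0 := by
    rw [← (hf x).fderiv]
    exact IsLocalMax.fderiv_eq_zero (Eventually.of_forall hmax)
  refine ⟨hgrad, fun v => ?_⟩
  have hline : ∀ s : ℝ, HasDerivAt (fun s : ℝ => x + s • v) v s := fun s => by
    simpa using ((hasDerivAt_id s).smul_const v).const_add x
  have hderiv : deriv (fun s : ℝ => f (x + s • v)) = fun s => f' (x + s • v) v :=
    funext fun s => ((hf _).comp_hasDerivAt s (hline s)).deriv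
  have hderiv' : HasDerivAt (fun s : ℝ => f' (x + s • v) v) (f'' v v) 0 := by
    have h := HasFDerivAt.comp_hasDerivAt_of_eq 0 hf' (hline 0) (by simp)
    simpa using h.clm_apply (hasDerivAt_const (0 : ℝ) v)
  by_contra! hpos
  have hmin : IsLocalMin (fun s : ℝ => f (x + s • v)) 0 :=
    isLocalMin_of_deriv_deriv_pos (by rwa [hderiv, hderiv'.deriv]) (by simp [hderiv, hgrad])
      ((hf _).comp_hasDerivAt 0 (hline 0)).continuousAt
  have hconst : (fun s : ℝ => f (x + s • v)) =ᶠ[𝓝 0] fun _ => f x :=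
    hmin.mono fun s hs => le_antisymm (hmax _) (by simpa using hs)
  have hzero := hconst.deriv.deriv_eq
  rw [hderiv, hderiv'.deriv, deriv_const', deriv_const] at hzero
  exact hpos.ne' hzero

lemma exists_symmetric_form_ge_sq [FiniteDimensional ℝ E] :
    ∃ Q : E →L[ℝ] E →L[ℝ] ℝ, (∀ v w, Q v w = Q w v) ∧ ∀ v, ‖v‖ ^ 2 ≤ Q v v := by
  let T := toEuclidean (E := E)
  let K := ‖T.symm.toContinuousLinearMap‖
  refine ⟨K ^ 2 • (innerSL ℝ).bilinearComp T.toContinuousLinearMap T.toContinuousLinearMap,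
    fun v w => ?_, fun v => ?_⟩
  · simp [real_inner_comm]
  · have hv : ‖v‖ ≤ K * ‖T v‖ := by
      simpa using T.symm.toContinuousLinearMap.le_opNorm (T v)
    calc ‖v‖ ^ 2 ≤ (K * ‖T v‖) ^ 2 := by gcongr
      _ = _ := by simp [mul_pow]

lemma hasFDerivAt_quadratic {Q : E →L[ℝ] E →L[ℝ] ℝ} (hQ : ∀ v w, Q v w = Q w v) (x₀ x : E) :
    HasFDerivAt (fun y => Q (y - x₀) (y - x₀)) ((2 : ℝ) • Q (x - x₀)) x := by
  have hid := (hasFDerivAt_id (𝕜 := ℝ) x).sub_const x₀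
  refine (Q.hasFDerivAt_of_bilinear hid hid).congr_fderiv ?_
  ext v
  simp [hQ v, two_mul]

lemma exists_max_sub_quadratic [ProperSpace E] {f : E → ℝ} (hf : Continuous f) {M κ : ℝ}
    (hM : ∀ x, f x ≤ M) {Q : E →L[ℝ] E →L[ℝ] ℝ} (hQ : ∀ v, ‖v‖ ^ 2 ≤ Q v v) (hκ : 0 < κ) (x₀ : E) :
    ∃ x, ∀ y, f y - κ * Q (y - x₀) (y - x₀) ≤ f x - κ * Q (x - x₀) (x - x₀) := by
  refine Continuous.exists_forall_ge' (by fun_prop) x₀ ?_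
  filter_upwards [(tendsto_dist_right_cocompact_atTop x₀).eventually_ge_atTop 1,
    (tendsto_dist_right_cocompact_atTop x₀).eventually_ge_atTop ((M - f x₀) / κ)] with x h₁ h₂
  rw [dist_eq_norm] at h₁ h₂
  have hpenalty : M - f x₀ ≤ κ * Q (x - x₀) (x - x₀) := by
    rw [← div_le_iff₀' hκ]
    exact h₂.trans ((le_self_pow₀ h₁ two_ne_zero).trans (hQ _))
  simp only [sub_self, map_zero, mul_zero, sub_zero]
  linarith [hM x]

lemma exists_pos_mul_le_mul_le (A B : ℝ) {δ ε : ℝ} (hδ : 0 < δ) (hε : 0 < ε) :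
    ∃ κ > 0, A * κ ≤ δ ∧ B * κ ≤ ε := by
  have hsmall : ∀ C r : ℝ, 0 < r → ∀ᶠ κ in 𝓝[>] (0 : ℝ), C * κ ≤ r := fun C r hr =>
    (((continuous_const_mul C).tendsto' 0 0 (mul_zero C)).mono_left
      nhdsWithin_le_nhds).eventually_le_const hr
  obtain ⟨κ, hκ⟩ := (((eventually_mem_nhdsWithin : ∀ᶠ κ in 𝓝[>] (0 : ℝ), κ ∈ Ioi 0).and
    ((hsmall A δ hδ).and (hsmall B ε hε)))).exists
  exact ⟨κ, hκ⟩

/-- The space of gradients and Hessians of functions on `E`, on which second-order differential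
operators `f ↦ F (jet f x)` act. -/
abbrev JetSpace (E : Type*) [NormedAddCommGroup E] [NormedSpace ℝ E] : Type _ :=
  (E →L[ℝ] ℝ) × (E →L[ℝ] E →L[ℝ] ℝ)

/-- The first and second derivatives of `f` at `x`. -/
noncomputable def jet (f : E → ℝ) (x : E) : JetSpace E :=
  (fderiv ℝ f x, fderiv ℝ (fderiv ℝ f) x)

lemma jet_sub {f g : E → ℝ} (hf : ContDiff ℝ 2 f) (hg : ContDiff ℝ 2 g) (x : E) :
    jet (f - g) x = jet f x - jet g x := by
  have hsub : fderiv ℝ (f - g) = fderiv ℝ f - fderiv ℝ g := funext fun y =>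
    fderiv_sub (hf.differentiable two_ne_zero y) (hg.differentiable two_ne_zero y)
  have hsub' : fderiv ℝ (fderiv ℝ f - fderiv ℝ g) x =
      fderiv ℝ (fderiv ℝ f) x - fderiv ℝ (fderiv ℝ g) x :=
    fderiv_sub ((hf.fderiv_right (m := 1) (by norm_num)).differentiable one_ne_zero x)
      ((hg.fderiv_right (m := 1) (by norm_num)).differentiable one_ne_zero x)
  rw [jet, hsub, hsub']
  rfl

lemma jet_comp_add_right (f : E → ℝ) (τ x : E) : jet (fun y => f (y + τ)) x = jet f (x + τ) := by
  have hfderiv : fderiv ℝ (fun y => f (y + τ)) = fun y => fderiv ℝ f (y + τ) :=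
    funext fun y => fderiv_comp_add_right τ
  rw [jet, hfderiv, fderiv_comp_add_right, jet]

-- The Omori–Yau maximum principle, at the maximum of `f - κ Q (· - x₀)` for a small `κ`.
lemma exists_almost_critical_of_bddAbove [ProperSpace E] {f : E → ℝ} (hf : ContDiff ℝ 2 f) {M ε : ℝ}
    (hM : ∀ x, f x ≤ M) {Q : E →L[ℝ] E →L[ℝ] ℝ} (hsymm : ∀ v w, Q v w = Q w v)
    (hQ : ∀ v, ‖v‖ ^ 2 ≤ Q v v) (hε : 0 < ε) (x₀ : E) :
    ∃ x, f x₀ ≤ f x ∧ ‖(jet f x).1‖ ≤ ε ∧ ∀ v, (jet f x).2 v v ≤ ε * Q v v := by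
  obtain ⟨κ, hκ, hκgrad, hκhess⟩ := exists_pos_mul_le_mul_le (4 * ‖Q‖ ^ 2 * (M - f x₀)) 2
    (pow_pos hε 2) hε
  obtain ⟨x, hx⟩ := exists_max_sub_quadratic hf.continuous hM hQ hκ x₀
  have hpenalty : f x₀ + κ * Q (x - x₀) (x - x₀) ≤ f x := by
    have h := hx x₀
    simp only [sub_self, map_zero, mul_zero, sub_zero] at h
    linarith
  have hpenalty_nonneg : 0 ≤ κ * Q (x - x₀) (x - x₀) :=
    mul_nonneg hκ.le ((sq_nonneg _).trans (hQ _))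
  have hQx : HasFDerivAt (fun y => κ • (2 : ℝ) • Q (y - x₀)) (κ • (2 : ℝ) • Q) x :=
    ((κ • (2 : ℝ) • Q).hasFDerivAt.sub_const (κ • (2 : ℝ) • Q x₀)).congr_of_eventuallyEq
      (Eventually.of_forall fun y => by simp [smul_sub])
  obtain ⟨hgrad, hhess⟩ := fderiv_eq_zero_and_hessian_nonpos_of_max
    (fun y => (hf.differentiable two_ne_zero y).hasFDerivAt.sub
      ((hasFDerivAt_quadratic hsymm x₀ y).const_mul κ))
    ((((hf.fderiv_right (m := 1) (by norm_num)).differentiable one_ne_zero x).hasFDerivAt).sub hQx)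
    hx
  refine ⟨x, by linarith, ?_, fun v => ?_⟩
  · rw [sub_eq_zero] at hgrad
    have hdist : κ * ‖x - x₀‖ ^ 2 ≤ M - f x₀ := by
      linarith [mul_le_mul_of_nonneg_left (hQ (x - x₀)) hκ.le, hM x]
    refine abs_le_of_sq_le_sq' ?_ hε.le |>.2
    calc ‖fderiv ℝ f x‖ ^ 2 ≤ (κ * (2 * (‖Q‖ * ‖x - x₀‖))) ^ 2 := by
          rw [hgrad, norm_smul, norm_smul, Real.norm_of_nonneg hκ.le, Real.norm_ofNat]
          gcongr
          exact Q.le_opNorm _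
      _ = 4 * ‖Q‖ ^ 2 * κ * (κ * ‖x - x₀‖ ^ 2) := by ring
      _ ≤ 4 * ‖Q‖ ^ 2 * κ * (M - f x₀) := by gcongr
      _ ≤ ε ^ 2 := by linarith
  · have h := hhess v
    simp only [sub_apply, smul_apply, smul_eq_mul] at h
    rw [jet]
    linarith [mul_le_mul_of_nonneg_right hκhess ((sq_nonneg _).trans (hQ v))]

/-- Degenerate ellipticity: the second-order operator `f ↦ F (jet f x)` is nondecreasing in the
Hessian, with symmetric bilinear forms ordered by their quadratic forms. -/
def IsDegenerateElliptic (F : JetSpace E → ℝ) : Prop :=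
  ∀ p A B, (∀ v w, A v w = A w v) → (∀ v w, B v w = B w v) → (∀ v, A v v ≤ B v v) →
    F (p, A) ≤ F (p, B)

lemma jet_snd_symm {f : E → ℝ} (hf : ContDiff ℝ 2 f) (x v w : E) :
    (jet f x).2 v w = (jet f x).2 w v :=
  hf.contDiffAt.isSymmSndFDerivAt (by simp) v w

lemma exists_dist_lt_of_continuous {X Y : Type*} [PseudoMetricSpace Y] [SeminormedAddCommGroup X]
    [ProperSpace X] {F : X → Y} (hF : Continuous F) (M : ℝ) {δ : ℝ} (hδ : 0 < δ) :
    ∃ θ > 0, ∀ J J', ‖J‖ ≤ M → dist J J' < θ → dist (F J) (F J') < δ := by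
  obtain ⟨θ, hθ, h⟩ := Metric.mem_uniformity_dist.1 <|
    (isCompact_closedBall (0 : X) M).uniformContinuousAt_of_continuousAt F
      (fun _ _ => hF.continuousAt) (Metric.dist_mem_uniformity hδ)
  exact ⟨θ, hθ, fun J J' hJ hJJ' => h hJJ' (mem_closedBall_zero_iff.2 hJ)⟩

theorem IsDegenerateElliptic.le_of_comparison [FiniteDimensional ℝ E]
    {F : JetSpace E → ℝ} (hF : IsDegenerateElliptic F) (hcont : Continuous F)
    {f g : E → ℝ} (hf : ContDiff ℝ 2 f) (hg : ContDiff ℝ 2 g) {c M N : ℝ} (hc : 0 < c)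
    (hM : ∀ x, ‖jet g x‖ ≤ M) (hN : ∀ x, f x - g x ≤ N)
    (hfg : ∀ x, g x < f x → c * (f x - g x) ≤ F (jet f x) - F (jet g x)) (x₀ : E) :
    f x₀ ≤ g x₀ := by
  by_contra! hlt
  obtain ⟨Q, hsymm, hQ⟩ := exists_symmetric_form_ge_sq (E := E)
  have := FiniteDimensional.proper_real (JetSpace E)
  obtain ⟨θ, hθ, hclose⟩ :=
    exists_dist_lt_of_continuous (X := JetSpace E) hcont M
      (mul_pos hc (sub_pos.2 hlt))
  obtain ⟨ε, hε, hεθ⟩ : ∃ ε > 0, ε * (1 + ‖Q‖) < θ :=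
    ⟨θ / (2 * (1 + ‖Q‖)), by positivity, by field_simp; linarith⟩
  obtain ⟨x, hx, hgrad, hhess⟩ :=
    exists_almost_critical_of_bddAbove (f := f - g) (hf.sub hg) hN hsymm hQ hε x₀
  rw [jet_sub hf hg] at hgrad hhess
  have hmono : F (jet f x) ≤ F ((jet f x).1, (jet g x).2 + ε • Q) := by
    refine hF (jet f x).1 (jet f x).2 _ (jet_snd_symm hf x) (fun v w => ?_) fun v => ?_
    · simp [hsymm v w, jet_snd_symm hg x v w]
    · simpa [add_comm] using hhess v
  have hgrad' : dist (jet g x).1 (jet f x).1 < θ := by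
    rw [dist_eq_norm']
    exact hgrad.trans_lt (by nlinarith [norm_nonneg Q])
  have hhess' : dist (jet g x).2 ((jet g x).2 + ε • Q) < θ := by
    refine (dist_self_add_right (ε • Q) (jet g x).2).trans_lt
      ((ContinuousLinearMap.opNorm_smul_le ε Q).trans_lt ?_)
    rw [Real.norm_of_nonneg hε.le]
    linarith
  have hnear := (abs_lt.1 (hclose (jet g x) ((jet f x).1, (jet g x).2 + ε • Q) (hM x)
    (max_lt hgrad' hhess'))).1
  simp only [Pi.sub_apply] at hx
  have hfar := (hfg x (by linarith)).trans (sub_le_sub_right hmono _)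
  nlinarith

lemma IsDegenerateElliptic.apply_add_le [FiniteDimensional ℝ E]
    {F : JetSpace E → ℝ} (hF : IsDegenerateElliptic F) (hcont : Continuous F)
    {f : E → ℝ} (hf : ContDiff ℝ 2 f) {c M N : ℝ} (hc : 0 < c)
    (hM : ∀ x, ‖jet f x‖ ≤ M) (hN : ∀ x, ‖f x‖ ≤ N) {τ : E}
    (hτ : ∀ x, f x < f (x + τ) →
      c * (f (x + τ) - f x) ≤ F (jet f (x + τ)) - F (jet f x)) (x : E) :
    f (x + τ) ≤ f x := by
  refine hF.le_of_comparison (f := fun y => f (y + τ)) hcont (by fun_prop) hf hc hM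
    (fun y => sub_le_sub (le_of_abs_le (hN (y + τ))) (neg_le_of_abs_le (hN y))) (fun y hy => ?_) x
  rw [jet_comp_add_right]
  exact hτ y hy

end EllipticComparison

section GraphCurvature

/-- The mean curvature of a graph over the plane, as a function of the gradient and the Hessian. -/
noncomputable def graphCurvature (J : JetSpace (Fin 2 → ℝ)) : ℝ :=
  ((1 + J.1 (Pi.single 1 1) ^ 2) * J.2 (Pi.single 0 1) (Pi.single 0 1)
      - 2 * J.1 (Pi.single 0 1) * J.1 (Pi.single 1 1) * J.2 (Pi.single 1 1) (Pi.single 0 1)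
      + (1 + J.1 (Pi.single 0 1) ^ 2) * J.2 (Pi.single 1 1) (Pi.single 1 1))
    / (1 + J.1 (Pi.single 0 1) ^ 2 + J.1 (Pi.single 1 1) ^ 2) ^ (3 / 2 : ℝ)

lemma pd_pd_eq {n : ℕ} {f : (Fin n → ℝ) → ℝ} (hf : ContDiff ℝ 2 f) (i j : Fin n) (x : Fin n → ℝ) :
    pd i (pd j f) x = fderiv ℝ (fderiv ℝ f) x (Pi.single i 1) (Pi.single j 1) := by
  have hfderiv := (hf.fderiv_right (m := 1) (by norm_num)).differentiable one_ne_zero x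
  have h := (hfderiv.hasFDerivAt.clm_apply
    (hasFDerivAt_const (Pi.single j 1 : Fin n → ℝ) x)).fderiv
  unfold pd
  simp [h]

lemma meanCurvature_eq_graphCurvature {η : (Fin 2 → ℝ) → ℝ} (hη : ContDiff ℝ 2 η)
    (x : Fin 2 → ℝ) : meanCurvature η x = graphCurvature (jet η x) := by
  simp only [meanCurvature, pd_pd_eq hη]
  rfl

lemma continuous_graphCurvature : Continuous graphCurvature := by
  unfold graphCurvature
  refine Continuous.div (by fun_prop) ?_ fun J => by positivity
  exact Continuous.rpow_const (by fun_prop) fun J => Or.inl (by positivity)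

-- With gradient `(p, q)`, the numerator is the trace of the Hessian plus its value on `(q, -p)`.
lemma isDegenerateElliptic_graphCurvature : IsDegenerateElliptic graphCurvature := by
  intro p A B hA hB hAB
  have h₀ := hAB (Pi.single 0 1)
  have h₁ := hAB (Pi.single 1 1)
  have h₂ := hAB (p (Pi.single 1 1) • Pi.single 0 1 - p (Pi.single 0 1) • Pi.single 1 1)
  simp only [map_sub, map_smul, sub_apply, smul_apply, smul_eq_mul,
    hA (Pi.single 0 1) (Pi.single 1 1), hB (Pi.single 0 1) (Pi.single 1 1)] at h₂
  unfold graphCurvature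
  gcongr ?_ / _
  linarith

lemma IsDegenerateElliptic.const_mul {E : Type*} [NormedAddCommGroup E] [NormedSpace ℝ E]
    {F : JetSpace E → ℝ} (hF : IsDegenerateElliptic F) {σ : ℝ}
    (hσ : 0 ≤ σ) : IsDegenerateElliptic fun J => σ * F J :=
  fun p A B hA hB hAB => mul_le_mul_of_nonneg_left (hF p A B hA hB hAB) hσ

end GraphCurvature

lemma FiniteCkNorm.exists_norm_le {n k : ℕ} {F : Type*} [NormedAddCommGroup F] [NormedSpace ℝ F]
    {S : Set (Fin n → ℝ)} {f : (Fin n → ℝ) → F} (h : FiniteCkNorm k S f) :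
    ∃ M, ∀ p ∈ S, ‖f p‖ ≤ M := by
  obtain ⟨M, hM⟩ := h
  exact ⟨M, fun p hp => by simpa using hM 0 (Nat.zero_le k) p hp⟩

lemma FiniteCkNorm.exists_norm_jet_le {n : ℕ} {f : (Fin n → ℝ) → ℝ}
    (h : FiniteCkNorm 2 univ f) : ∃ M, ∀ x, ‖jet f x‖ ≤ M := by
  obtain ⟨M, hM⟩ := h
  refine ⟨M, fun x => max_le ?_ ?_⟩
  · exact norm_iteratedFDeriv_one (𝕜 := ℝ) f ▸ hM 1 one_le_two x trivial
  · have hhess := hM 2 le_rfl x trivial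
    rwa [← norm_iteratedFDeriv_fderiv, norm_iteratedFDeriv_one] at hhess

section Interface

variable {ρ₁ ρ₂ g γ₁ γ₂ a b M₁ M₂ δ t z : ℝ} {bed η lid : (Fin 2 → ℝ) → ℝ}
  {u₁ u₂ : (Fin 3 → ℝ) → (Fin 3 → ℝ)} {P₁ P₂ : (Fin 3 → ℝ) → ℝ} {x x' : Fin 2 → ℝ}

lemma exists_apply_add_smul_eq {E : Type*} [NormedAddCommGroup E] [NormedSpace ℝ E] {f : E → ℝ}
    (hf : Continuous f) {x e : E} (hz : z ∈ Icc (f x) (f (x + t • e))) :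
    ∃ s : ℝ, f (x + s • e) = z := by
  have hline : Continuous fun s : ℝ => f (x + s • e) := by fun_prop
  exact mem_range_of_exists_le_of_exists_ge hline ⟨0, by simpa using hz.1⟩ ⟨t, hz.2⟩

lemma le_pressure_slope_sub_of_mem_Icc
    (H₁ : IsHorizontalVorticityFlow ρ₁ g γ₁ a b (layer bed η) u₁ P₁)
    (H₂ : IsHorizontalVorticityFlow ρ₂ g γ₂ a b (layer η lid) u₂ P₂)
    (hL₁ : SlabSeparated bed η) (hL₂ : SlabSeparated η lid)
    (hM₁ : ∀ p ∈ layer bed η, ‖u₁ p‖ ≤ M₁) (hM₂ : ∀ p ∈ layer η lid, ‖u₂ p‖ ≤ M₂)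
    (hδ : ∀ y, pdWithin (closure (layer bed η)) 2 P₁ (atHeight y (η y))
      - pdWithin (closure (layer η lid)) 2 P₂ (atHeight y (η y)) ≤ -δ)
    (hx' : x' = x + t • ![a, b]) (hz : z ∈ Icc (η x) (η x')) :
    δ ≤ pdWithin (closure (layer η lid)) 2 P₂ (atHeight x z)
      - pdWithin (closure (layer bed η)) 2 P₁ (atHeight x' z) := by
  obtain ⟨s, hs⟩ := exists_apply_add_smul_eq hL₁.continuous_hi (hx' ▸ hz)
  set y := x + s • ![a, b]
  have hy : x' = y + (t - s) • ![a, b] := by rw [hx']; module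
  have h₁ := H₁.pdWithin_pressure_atHeight_eq hL₁ hM₁ hy (z := z)
    ⟨⟨hs ▸ (hL₁.lo_lt_hi y y).le, hs.ge⟩, (hL₁.lo_lt_hi x' x).le.trans hz.1, hz.2⟩
  have h₂ := H₂.pdWithin_pressure_atHeight_eq hL₂ hM₂ (t := s) (x := x) (x' := y) rfl (z := z)
    ⟨⟨hz.1, hz.2.trans (hL₂.lo_lt_hi x' x).le⟩, hs.le, hs ▸ (hL₂.lo_lt_hi y y).le⟩
  have hδy := hδ y
  rw [hs, h₁, ← h₂] at hδy
  linarith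

lemma mul_sub_le_pressure_jump_sub
    (H₁ : IsHorizontalVorticityFlow ρ₁ g γ₁ a b (layer bed η) u₁ P₁)
    (H₂ : IsHorizontalVorticityFlow ρ₂ g γ₂ a b (layer η lid) u₂ P₂)
    (hL₁ : SlabSeparated bed η) (hL₂ : SlabSeparated η lid)
    (hM₁ : ∀ p ∈ layer bed η, ‖u₁ p‖ ≤ M₁) (hM₂ : ∀ p ∈ layer η lid, ‖u₂ p‖ ≤ M₂)
    (hδ : ∀ y, pdWithin (closure (layer bed η)) 2 P₁ (atHeight y (η y))
      - pdWithin (closure (layer η lid)) 2 P₂ (atHeight y (η y)) ≤ -δ)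
    (hx' : x' = x + t • ![a, b]) (hlt : η x < η x') :
    δ * (η x' - η x) ≤ (P₂ (atHeight x' (η x')) - P₁ (atHeight x' (η x')))
      - (P₂ (atHeight x (η x)) - P₁ (atHeight x (η x))) := by
  have hsub₂ : Icc (η x) (η x') ⊆ Icc (η x) (lid x) :=
    Icc_subset_Icc_right (hL₂.lo_lt_hi x' x).le
  have hsub₁ : Icc (η x) (η x') ⊆ Icc (bed x') (η x') :=
    Icc_subset_Icc_left (hL₁.lo_lt_hi x' x).le
  have hderiv : ∀ z ∈ Icc (η x) (η x'),
      HasDerivWithinAt (fun z => P₂ (atHeight x z) - P₁ (atHeight x' z))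
        (pdWithin (closure (layer η lid)) 2 P₂ (atHeight x z)
          - pdWithin (closure (layer bed η)) 2 P₁ (atHeight x' z)) (Icc (η x) (η x')) z :=
    fun z hz =>
      ((hL₂.hasDerivWithinAt_atHeight (H₂.euler.contDiffOn_pressure.differentiableOn one_ne_zero)
        (hsub₂ hz)).mono hsub₂).sub
      ((hL₁.hasDerivWithinAt_atHeight (H₁.euler.contDiffOn_pressure.differentiableOn one_ne_zero)
        (hsub₁ hz)).mono hsub₁)
  have hgrowth := (convex_Icc (η x) (η x')).mul_sub_le_image_sub_of_le_deriv
    (fun z hz => (hderiv z hz).continuousWithinAt)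
    (fun z hz => ((hderiv z (interior_subset hz)).mono interior_subset).differentiableWithinAt)
    (fun z hz => by
      rw [((hderiv z (interior_subset hz)).hasDerivAt (mem_interior_iff_mem_nhds.1 hz)).deriv]
      exact le_pressure_slope_sub_of_mem_Icc H₁ H₂ hL₁ hL₂ hM₁ hM₂ hδ hx' (interior_subset hz))
    (η x) (left_mem_Icc.2 hlt.le) (η x') (right_mem_Icc.2 hlt.le) hlt.le
  have htop := H₂.pressure_atHeight_eq_of_mem_Icc hL₂ hM₂ hx' (z := η x')
    ⟨hsub₂ (right_mem_Icc.2 hlt.le), left_mem_Icc.2 (hL₂.lo_lt_hi x' x').le⟩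
  have hbottom := H₁.pressure_atHeight_eq_of_mem_Icc hL₁ hM₁ hx' (z := η x)
    ⟨right_mem_Icc.2 (hL₁.lo_lt_hi x x).le, hsub₁ (left_mem_Icc.2 hlt.le)⟩
  rw [htop, ← hbottom] at hgrowth
  linarith

end Interface

lemma vertical_vorticity_eq_zero {ρ g M : ℝ} {lo hi : (Fin 2 → ℝ) → ℝ}
    {u : (Fin 3 → ℝ) → (Fin 3 → ℝ)} {P : (Fin 3 → ℝ) → ℝ} {ω : Fin 3 → ℝ}
    (hL : SlabSeparated lo hi) (hE : IsSteadyEuler ρ g (layer lo hi) u P)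
    (hω : ∀ p ∈ layer lo hi, curl u p = ω) (hM : ∀ p ∈ layer lo hi, ‖u p‖ ≤ M) : ω 2 = 0 := by
  obtain ⟨c₁, c₂, hc, hbounds⟩ := hL.exists_slab
  obtain ⟨c, hcI⟩ := nonempty_Ioo.2 hc
  have hplane : ∀ p : Fin 3 → ℝ, p 2 = c → p ∈ layer lo hi := fun p hp =>
    slab_subset_layer hbounds (show p 2 ∈ Ioo c₁ c₂ from hp ▸ hcI)
  exact curl_vertical_eq_zero_of_bounded
    (fun p hp => hE.differentiableAt_velocity hL.isOpen_layer (hplane p hp))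
    (fun p hp => congrFun (hω p (hplane p hp)) 2) (fun p hp => hM p (hplane p hp))

lemma exists_unit_horizontal_direction {ω : Fin 3 → ℝ} (hω : ω ≠ 0) (hvert : ω 2 = 0) :
    ∃ a b r : ℝ, a ^ 2 + b ^ 2 = 1 ∧ r ≠ 0 ∧ ω = r • ![a, b, 0] := by
  let w : ℂ := ⟨ω 0, ω 1⟩
  have hpolar : ω = ‖w‖ • ![Real.cos w.arg, Real.sin w.arg, 0] := by
    ext i
    fin_cases i
    · exact (Complex.norm_mul_cos_arg w).symm
    · exact (Complex.norm_mul_sin_arg w).symm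
    · simpa using hvert
  refine ⟨_, _, ‖w‖, Real.cos_sq_add_sin_sq w.arg, fun hw => hω ?_, hpolar⟩
  rw [hpolar, hw, zero_smul]

lemma IsCapillaryGravityWave.slabSeparated {ρ₁ ρ₂ g σ h₁ h₂ : ℝ} {η : (Fin 2 → ℝ) → ℝ}
    {u₁ u₂ : (Fin 3 → ℝ) → (Fin 3 → ℝ)} {P₁ P₂ : (Fin 3 → ℝ) → ℝ}
    (hwave : IsCapillaryGravityWave ρ₁ ρ₂ g σ h₁ h₂ η u₁ u₂ P₁ P₂) :
    SlabSeparated (fun _ => -h₁) η ∧ SlabSeparated η fun _ => h₂ := by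
  obtain ⟨δ₁, hδ₁, hbed⟩ := hwave.above_bed
  obtain ⟨δ₂, hδ₂, hlid⟩ := hwave.below_lid
  have hη := hwave.contDiff_interface.continuous
  exact ⟨⟨continuous_const, hη, -h₁, -h₁ + δ₁, by linarith, fun x => ⟨le_rfl, hbed x⟩⟩,
    ⟨hη, continuous_const, h₂ - δ₂, h₂, by linarith, fun x => ⟨hlid x, le_rfl⟩⟩⟩

theorem theorem3_general {ρ₁ ρ₂ g : ℝ} (hρ₁ : ρ₁ ≠ 0) (hρ₂ : ρ₂ ≠ 0)
    {bed η lid : (Fin 2 → ℝ) → ℝ} {u₁ u₂ : (Fin 3 → ℝ) → (Fin 3 → ℝ)} {P₁ P₂ : (Fin 3 → ℝ) → ℝ}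
    (hL₁ : SlabSeparated bed η) (hL₂ : SlabSeparated η lid)
    (hE₁ : IsSteadyEuler ρ₁ g (layer bed η) u₁ P₁) (hE₂ : IsSteadyEuler ρ₂ g (layer η lid) u₂ P₂)
    {F : JetSpace (Fin 2 → ℝ) → ℝ} (hF : IsDegenerateElliptic F) (hcont : Continuous F)
    (hη : ContDiff ℝ 2 η) (hjump : ∀ x, P₂ (atHeight x (η x)) - P₁ (atHeight x (η x)) = F (jet η x))
    {ω₁ ω₂ : Fin 3 → ℝ} (hω₁ : ∀ p ∈ layer bed η, curl u₁ p = ω₁)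
    (hω₂ : ∀ p ∈ layer η lid, curl u₂ p = ω₂) (hω₁0 : ω₁ ≠ 0) (hω₂0 : ω₂ ≠ 0)
    (hpar : ∃ c : ℝ, ω₁ = c • ω₂) (hu₁ : ∃ M, ∀ p ∈ layer bed η, ‖u₁ p‖ ≤ M)
    (hu₂ : ∃ M, ∀ p ∈ layer η lid, ‖u₂ p‖ ≤ M) (hηb : FiniteCkNorm 2 univ η)
    (hsign : ∃ δ > 0, ∀ x, pdWithin (closure (layer bed η)) 2 P₁ (atHeight x (η x))
      - pdWithin (closure (layer η lid)) 2 P₂ (atHeight x (η x)) ≤ -δ) :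
    ∃ a b : ℝ, a ^ 2 + b ^ 2 = 1 ∧
      (∃ c₁ : ℝ, ω₁ = c₁ • ![a, b, 0]) ∧ (∃ c₂ : ℝ, ω₂ = c₂ • ![a, b, 0]) ∧
      (∀ (x : Fin 2 → ℝ) (t : ℝ), η (x + t • ![a, b]) = η x) ∧
      IsTwoDimensionalFlow ![a, b, 0] (closure (layer bed η)) u₁ P₁ ∧
      IsTwoDimensionalFlow ![a, b, 0] (closure (layer η lid)) u₂ P₂ := by
  obtain ⟨M₁, hM₁⟩ := hu₁
  obtain ⟨M₂, hM₂⟩ := hu₂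
  obtain ⟨δ, hδ, hslope⟩ := hsign
  obtain ⟨c, rfl⟩ := hpar
  obtain ⟨a, b, r, hab, hr, rfl⟩ :=
    exists_unit_horizontal_direction hω₂0 (vertical_vorticity_eq_zero hL₂ hE₂ hω₂ hM₂)
  rw [smul_smul] at hω₁ hω₁0
  have H₁ : IsHorizontalVorticityFlow ρ₁ g (c * r) a b (layer bed η) u₁ P₁ :=
    ⟨hρ₁, left_ne_zero_of_smul hω₁0, hab, hL₁.isOpen_layer, hE₁, hω₁⟩
  have H₂ : IsHorizontalVorticityFlow ρ₂ g r a b (layer η lid) u₂ P₂ :=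
    ⟨hρ₂, hr, hab, hL₂.isOpen_layer, hE₂, hω₂⟩
  obtain ⟨M, hM⟩ := hηb.exists_norm_jet_le
  obtain ⟨N, hN⟩ := hηb.exists_norm_le
  have hle : ∀ (x : Fin 2 → ℝ) (t : ℝ), η (x + t • ![a, b]) ≤ η x := fun x t =>
    hF.apply_add_le hcont hη hδ hM (fun y => hN y trivial) (fun y hy => by
      rw [← hjump, ← hjump]
      exact mul_sub_le_pressure_jump_sub H₁ H₂ hL₁ hL₂ hM₁ hM₂ hslope rfl hy) x
  refine ⟨a, b, hab, ⟨c * r, smul_smul c r _⟩, ⟨r, rfl⟩, fun x t => (hle x t).antisymm ?_,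
    H₁.isTwoDimensionalFlow hL₁ hM₁, H₂.isTwoDimensionalFlow hL₂ hM₂⟩
  have hback := hle (x + t • ![a, b]) (-t)
  rwa [add_assoc, ← add_smul, add_neg_cancel, zero_smul, add_zero] at hback

theorem theorem3 (ρ₁ ρ₂ g σ h₁ h₂ : ℝ) (hρ₁ : 0 < ρ₁) (hρ₂ : 0 < ρ₂) (hσ : 0 < σ)
    (hh₁ : 0 < h₁) (hh₂ : 0 < h₂)
    (η : (Fin 2 → ℝ) → ℝ) (u₁ u₂ : (Fin 3 → ℝ) → (Fin 3 → ℝ)) (P₁ P₂ : (Fin 3 → ℝ) → ℝ)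
    (hwave : IsCapillaryGravityWave ρ₁ ρ₂ g σ h₁ h₂ η u₁ u₂ P₁ P₂)
    -- the vorticities are constant, nonzero and parallel
    (ω₁ ω₂ : Fin 3 → ℝ)
    (hω₁ : ∀ p ∈ lowerLayer h₁ η, curl u₁ p = ω₁) (hω₂ : ∀ p ∈ upperLayer h₂ η, curl u₂ p = ω₂)
    (hω₁0 : ω₁ ≠ 0) (hω₂0 : ω₂ ≠ 0) (hpar : ∃ c : ℝ, ω₁ = c • ω₂)
    -- finite norms
    (hu₁ : FiniteCkNorm 1 (lowerLayer h₁ η) u₁) (hu₂ : FiniteCkNorm 1 (upperLayer h₂ η) u₂)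
    (hη : FiniteCkNorm 2 Set.univ η)
    -- the supremum of `∂P₁/∂z - ∂P₂/∂z` over the interface is negative
    (hsign : ∃ δ : ℝ, 0 < δ ∧ ∀ x : Fin 2 → ℝ,
      pdWithin (closure (lowerLayer h₁ η)) 2 P₁ (interfacePoint η x)
        - pdWithin (closure (upperLayer h₂ η)) 2 P₂ (interfacePoint η x) ≤ -δ) :
    -- the wave is two dimensional: nothing varies along a horizontal direction `(a, b, 0)`
    ∃ a b : ℝ, a ^ 2 + b ^ 2 = 1 ∧
      (∃ c₁ : ℝ, ω₁ = c₁ • ![a, b, 0]) ∧ (∃ c₂ : ℝ, ω₂ = c₂ • ![a, b, 0]) ∧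
      (∀ (x : Fin 2 → ℝ) (t : ℝ), η (x + t • ![a, b]) = η x) ∧
      IsTwoDimensionalFlow ![a, b, 0] (closure (lowerLayer h₁ η)) u₁ P₁ ∧
      IsTwoDimensionalFlow ![a, b, 0] (closure (upperLayer h₂ η)) u₂ P₂ := by
  obtain ⟨hL₁, hL₂⟩ := hwave.slabSeparated
  have hη₂ := hwave.contDiff_interface
  exact theorem3_general hρ₁.ne' hρ₂.ne' hL₁ hL₂ hwave.euler_lower hwave.euler_upper
    (isDegenerateElliptic_graphCurvature.const_mul hσ.le) (continuous_graphCurvature.const_mul σ)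
    hη₂ (fun x => meanCurvature_eq_graphCurvature hη₂ x ▸ hwave.young_laplace x)
    hω₁ hω₂ hω₁0 hω₂0 hpar hu₁.exists_norm_le hu₂.exists_norm_le hη hsign
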